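/- Let $\square\subset\mathbb{R}^d$ be a convex polytope (the convex hull of finitely many points), let $S\subset\square$ be a finite set of data points, and let $\Diamond=\mathrm{conv}(S)$. For a convex polytope $K$ and a pair of dimensions $p=(d_1,d_2)$, $d_1<d_2$, let $\Pi_p(K)$ be the projection of $K$ onto these two dimensions, $L_p(K)$ the perimeter of this polygon (twice the length if it degenerates to a segment, $0$ if it is a point), $\Lambda(K)=\sum_p L_p(K)$, and $l_{\Pi_p(K)}(\theta)$ the orthogonal projection of $\Pi_p(K)$ onto the line $\mathbb{R}(\cos\theta,\sin\theta)$. A random cutting hyperplane $C=(p,\theta,\mathbf u)$ is *generated in* $K$ (where $\Lambda(K)>0$) as follows: choose $p$ with probability $L_p(K)/\Lambda(K)$, then $\theta\in(0,\pi]$ with density proportional to $|l_{\Pi_p(K)}(\theta)|$, then $\mathbf u$ uniformly on the segment $l_{\Pi_p(K)}(\theta)$; its hyperplane in $K$ is $\{x\in K: ((x_{d_1},x_{d_2})-\mathbf u)\cdot(\cos\theta,\sin\theta)=0\}$. $\mathrm{BlockCut}(K,\tau)$ is the random tree obtained by sampling a cost $c\sim\mathrm{Exp}(\Lambda(K))$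 ($c=\infty$ if $\Lambda(K)=0$); if $c\ge\tau$ it is a single leaf, and otherwise a cut $C$ is generated in $K$, the root is labelled $(c,C)$, and its two subtrees are independent copies of $\mathrm{BlockCut}(K',\tau-c)$ and $\mathrm{BlockCut}(K'',\tau-c)$, where $K',K''$ are the parts of $K$ on the two sides of the cut. $\mathrm{HullCut}(S,\tau)$ is defined in the same way, with the cost and the cut generated in $\mathrm{conv}(S)$, and with the subtrees $\mathrm{HullCut}(S',\tau-c)$ and $\mathrm{HullCut}(S'',\tau-c)$, where $S',S''$ are the data points on the two sides of the cut. The *restriction* of a tree of cuts of $\square$ to $\Diamond$ keeps a cut if its hyperplane meets $\Diamond$ (its two subtrees are then restricted to the two parts of $\Diamond$), and otherwise skips it, continuing in the sub-block that contains $\Diamond$ and adding the cost of the skipped cut to the cost of the next cut. The restriction to the data hulls of $S$ is defined in the same way, with $\mathrm{conv}(S)$ in place of $\Diamond$ and with $S',S''$ in place of the two parts of $\Diamond$. Then: 1. If $\Lambda(\Diamond)>0$, the law of a cutting hyperplane generated in $\Diamond$ is a probability measure, and it equals the law of a cutting hyperplane generated in $\square$, conditioned on meeting $\Diamond$. 2.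 For every budget $\tau\in\mathbb{R}$, the recursions $\mathrm{BlockCut}(\square,\tau)$ and $\mathrm{HullCut}(S,\tau)$ stop almost surely. The tree $\mathrm{HullCut}(S,\tau)$ (costs, hyperplanes and tree structure) has the same law as the restriction of $\mathrm{BlockCut}(\square,\tau)$ to the data hulls of $S$. 3. For every $\tau\in\mathbb{R}$, $\mathrm{BlockCut}(\Diamond,\tau)$ has the same law as the restriction of $\mathrm{BlockCut}(\square,\tau)$ to $\Diamond$. -/

import Mathlib

open MeasureTheory ProbabilityTheory

namespace BSP

/-! ### Planar geometry -/

/-- The Euclidean plane. -/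
abbrev Plane : Type := EuclideanSpace ℝ (Fin 2)

/-- `x` lies on or to the left of the oriented line through `p` and `q`. -/
def LeftOf (p q x : Plane) : Prop :=
  0 ≤ (q 0 - p 0) * (x 1 - p 1) - (q 1 - p 1) * (x 0 - p 0)

/-- `(p, q)` is a counterclockwise oriented edge of the convex polygon `Q`: two distinct vertices
such that `Q` lies to the left of the line through them.
A polygon that degenerates to a segment has the two edges `(p, q)` and `(q, p)`. -/
def IsEdge (Q : Set Plane) (e : Plane × Plane) : Prop :=
  e.1 ∈ Q.extremePoints ℝ ∧ e.2 ∈ Q.extremePoints ℝ ∧ e.1 ≠ e.2 ∧ ∀ x ∈ Q, LeftOf e.1 e.2 x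

/-- The perimeter of a convex polygon: the sum of the lengths of its edges
(a degenerate polygon, i.e. a segment, has as perimeter twice its length; a point has `0`). -/
noncomputable def perimeter (Q : Set Plane) : ENNReal :=
  ∑' e : {e : Plane × Plane // IsEdge Q e}, edist e.1.1 e.1.2

/-- The segment `l_Q(θ)` of `Q` in the direction `θ`: the orthogonal projection of `Q` onto the
line `ℝ • (cos θ, sin θ)`, written in the arc length coordinate `s` of the point
`s • (cos θ, sin θ)`. -/
def dirSegment (Q : Set Plane) (θ : ℝ) : Set ℝ :=
  (fun y : Plane => y 0 * Real.cos θ + y 1 * Real.sin θ) '' Q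

/-- The law of the angle: density on `(0, π]` proportional to `|l_Q(θ)|`. -/
noncomputable def angleLaw (Q : Set Plane) : Measure ℝ :=
  (∫⁻ θ in Set.Ioc 0 Real.pi, volume (dirSegment Q θ))⁻¹ •
    (volume.restrict (Set.Ioc 0 Real.pi)).withDensity (fun θ => volume (dirSegment Q θ))

/-- The law of the cutting position: uniform on the segment `l_Q(θ)`. -/
noncomputable def positionLaw (Q : Set Plane) (θ : ℝ) : Measure ℝ :=
  ProbabilityTheory.cond volume (dirSegment Q θ)

/-- The joint law of angle and position: sample the angle, then the position given the angle. -/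
noncomputable def lineLaw (Q : Set Plane) : Measure (ℝ × ℝ) :=
  (angleLaw Q).bind fun θ => (positionLaw Q θ).map fun s => (θ, s)

/-! ### Cutting hyperplanes in `ℝ^d` -/

/-- `ℝ^d`. -/
abbrev Space (d : ℕ) : Type := EuclideanSpace ℝ (Fin d)

/-- The set of pairs of dimensions. -/
abbrev DimPair (d : ℕ) : Type := {p : Fin d × Fin d // p.1 < p.2}

/-- The projection onto a pair of dimensions. -/
noncomputable def proj {d : ℕ} (p : DimPair d) (x : Space d) : Plane := !₂[x p.1.1, x p.1.2]

/-- The sum of the perimeters of all two-dimensional projections. -/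
noncomputable def totalPerimeter {d : ℕ} (K : Set (Space d)) : ENNReal :=
  ∑ p : DimPair d, perimeter (proj p '' K)

/-- The parameters of a cutting hyperplane: pair of dimensions, angle `θ`, and the coordinate `s`
of the cutting position `u = s • (cos θ, sin θ)`. -/
abbrev Cut (d : ℕ) : Type := DimPair d × ℝ × ℝ

/-- The angle of a cut. -/
def Cut.angle {d : ℕ} (C : Cut d) : ℝ := C.2.1

/-- The cutting position of a cut, as a point of the plane of the chosen pair of dimensions. -/
noncomputable def Cut.pos {d : ℕ} (C : Cut d) : Plane :=
  !₂[C.2.2 * Real.cos C.angle, C.2.2 * Real.sin C.angle]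

/-- The signed distance of `x` from the cutting hyperplane
(`(cos θ, sin θ)` is the normal direction `(1, tan θ)`, normalised so that `θ = π / 2` makes
sense). -/
noncomputable def Cut.offset {d : ℕ} (C : Cut d) (x : Space d) : ℝ :=
  (proj C.1 x 0 - C.pos 0) * Real.cos C.angle + (proj C.1 x 1 - C.pos 1) * Real.sin C.angle

/-- The cutting hyperplane, restricted to `K`. -/
def hyperplane {d : ℕ} (K : Set (Space d)) (C : Cut d) : Set (Space d) := {x ∈ K | C.offset x = 0}

/-- The part of `K` on the first side of the cut. -/
def leftPart {d : ℕ} (K : Set (Space d)) (C : Cut d) : Set (Space d) := {x ∈ K | C.offset x ≤ 0}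

/-- The part of `K` on the second side of the cut. -/
def rightPart {d : ℕ} (K : Set (Space d)) (C : Cut d) : Set (Space d) := {x ∈ K | 0 ≤ C.offset x}

/-- The law of the pair of dimensions: proportional to the perimeters of the projections. -/
noncomputable def pairLaw {d : ℕ} (K : Set (Space d)) : Measure (DimPair d) :=
  ∑ p : DimPair d, (perimeter (proj p '' K) / totalPerimeter K) • Measure.dirac p

/-- The law of a cutting hyperplane generated in the block `K`: sample the pair of dimensions,
then angle and position in the projection of `K` onto that pair. -/
noncomputable def cutLaw {d : ℕ} (K : Set (Space d)) : Measure (Cut d) :=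
  (pairLaw K).bind fun p => (lineLaw (proj p '' K)).map fun y => (p, y)

/-! ### Trees of cuts -/

/-- Finite binary trees whose inner nodes carry labels in `α`. -/
inductive BinTree (α : Type) : Type
  | leaf : BinTree α
  | node : α → BinTree α → BinTree α → BinTree α

/-- The label at an address of a tree (`Sum.inl ()` if there is no inner node there). -/
def BinTree.label {α : Type} : BinTree α → List Bool → Unit ⊕ α
  | .leaf, _ => Sum.inl ()
  | .node a _ _, [] => Sum.inr a
  | .node _ l r, b :: w => if b then r.label w else l.label w

/-- The σ-algebra on trees generated by the labels at all addresses. -/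
instance {α : Type} [MeasurableSpace α] : MeasurableSpace (BinTree α) :=
  MeasurableSpace.comap BinTree.label inferInstance

/-- A tree of cuts: every inner node carries the cost of its cut and the cutting hyperplane. -/
abbrev CutTree (d : ℕ) : Type := BinTree (ℝ × Cut d)

/-- The law of the output of the recursive cutting procedure on the domain `D` with budget `τ`, on
the event that the recursion has fewer than `n` levels of nested cuts.
The block that is cut in the domain `D` is `hull D`, and the two parts of `D` are treated
independently with the remaining budget. The cost is exponential with rate the total
perimeter of the block; it is infinite if this rate is `0`. -/
noncomputable def treeLawUpTo {d : ℕ} (hull : Set (Space d) → Set (Space d)) :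
    ℕ → Set (Space d) → ℝ → Measure (CutTree d)
  | 0, _, _ => 0
  | n + 1, D, τ =>
    open Classical in
    if totalPerimeter (hull D) = 0 then Measure.dirac .leaf
    else (expMeasure (totalPerimeter (hull D)).toReal).bind fun c =>
      if c < τ then
        (cutLaw (hull D)).bind fun C =>
          ((treeLawUpTo hull n (leftPart D C) (τ - c)).prod
            (treeLawUpTo hull n (rightPart D C) (τ - c))).map
              fun t => BinTree.node (c, C) t.1 t.2
      else Measure.dirac .leaf

/-- The law of the output of the recursive cutting procedure. -/
noncomputable def treeLaw {d : ℕ} (hull : Set (Space d) → Set (Space d)) (D : Set (Space d))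
    (τ : ℝ) : Measure (CutTree d) :=
  ⨆ n, treeLawUpTo hull n D τ

/-- The law of the BSP-tree on the block `K` with budget `τ`: the sub-blocks are the parts of the
block on the two sides of the cut. -/
noncomputable def blockCutLaw {d : ℕ} (K : Set (Space d)) (τ : ℝ) : Measure (CutTree d) :=
  treeLaw id K τ

/-- The law of the tree of data hulls with budget `τ`: the convex hull of the data is cut, and the
sub-blocks are the convex hulls of the data on the two sides of the cut. -/
noncomputable def hullCutLaw {d : ℕ} (S : Set (Space d)) (τ : ℝ) : Measure (CutTree d) :=
  treeLaw (fun A => convexHull ℝ A) S τ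

open Classical in
/-- Restriction of a tree of cuts to the domain `D`: a cut is kept if it meets `hull D`, and
otherwise the restriction is continued in the sub-block that contains `D`.
The argument `a` is the accumulated cost of the cuts skipped since the last cut kept. -/
noncomputable def restrictFrom {d : ℕ} (hull : Set (Space d) → Set (Space d)) :
    CutTree d → Set (Space d) → ℝ → CutTree d
  | .leaf, _, _ => .leaf
  | .node (c, C) l r, D, a =>
    if (hyperplane (hull D) C).Nonempty then
      .node (a + c, C) (restrictFrom hull l (leftPart D C) 0)
        (restrictFrom hull r (rightPart D C) 0)
    else if leftPart D C = D then restrictFrom hull l D (a + c)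
    else restrictFrom hull r D (a + c)

/-- Restriction of a BSP-tree to a convex subdomain `K`. -/
noncomputable def restrictToBlock {d : ℕ} (K : Set (Space d)) (t : CutTree d) : CutTree d :=
  restrictFrom id t K 0

/-- Restriction of a BSP-tree to the convex hulls of the data `S`. -/
noncomputable def restrictToHulls {d : ℕ} (S : Set (Space d)) (t : CutTree d) : CutTree d :=
  restrictFrom (fun A => convexHull ℝ A) t S 0

end BSP

namespace BSP

/-! The proof rests on integral geometry and on the memorylessness of exponential clocks. By
Cauchy's formula (`perimeter_eq_lintegral`) the perimeter of a convex polygon is the integral over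
`(0, π]` of its shadow lengths, that is, the `dθ ds`-measure of the lines that meet it. Summed over
pairs of dimensions, `Λ(conv D)` is the mass that one fixed measure `cutMeasure` gives to the cuts
meeting `conv D` (`totalPerimeter_eq`), and all normalisations in the sampling of a cut cancel, so
that a generated cut is `cutMeasure` conditioned on meeting the block (`cutLaw_eq_cond`). Part 1 is
then iterated conditioning.

For the trees, cuts of a block `K` arrive at rate `Λ(K)`. Those that meet a domain `D ⊆ K` have rate
`Λ(D)` and the right conditional law; after a cut that misses `D`, the domain lies in one sub-block
and the clock restarts. `exponential_thinning` expresses that the accumulated waiting time is again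
exponential with rate `Λ(D)`.

Since sub-blocks change at each cut, the comparison is an induction on the number of levels, and it
yields only an inequality of measures (`hullLawUpTo_map_restrict_le`). This suffices once both sides
are known to have mass one, which is the almost sure termination `isProbabilityMeasure_hullLaw`: the
mass missing after `n` levels decays like `2⁻ⁿ`.

Data sets and blocks are treated together as domains whose convex hull is cut, since a convex block
is its own hull. Measurability in the domain is obtained from families with closed graph inside a
compact set. -/

/-- The height of `y` in direction `(a, b)`. -/
def height (a b : ℝ) (y : Plane) : ℝ := y 0 * a + y 1 * b

lemma isLinearMap_height (a b : ℝ) : IsLinearMap ℝ (height a b) where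
  map_add x y := by simp [height]; ring
  map_smul c x := by simp [height]; ring

lemma continuous_height (a b : ℝ) : Continuous (height a b) := by
  unfold height; fun_prop

lemma height_neg (a b : ℝ) (y : Plane) : height (-a) (-b) y = -height a b y := by
  simp [height]; ring

/-- The orientation determinant is invariant under rotation, so it may be computed in the
orthonormal frame `(a, b)`, `(-b, a)`. -/
lemma leftOf_iff_height {a b : ℝ} (hab : a ^ 2 + b ^ 2 = 1) (p q x : Plane) :
    LeftOf p q x ↔ 0 ≤ (height a b q - height a b p) * (height (-b) a x - height (-b) a p) -
      (height (-b) a q - height (-b) a p) * (height a b x - height a b p) := by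
  unfold LeftOf height
  have : (q 0 * a + q 1 * b - (p 0 * a + p 1 * b)) * (x 0 * -b + x 1 * a - (p 0 * -b + p 1 * a)) -
      (q 0 * -b + q 1 * a - (p 0 * -b + p 1 * a)) * (x 0 * a + x 1 * b - (p 0 * a + p 1 * b)) =
      (a ^ 2 + b ^ 2) * ((q 0 - p 0) * (x 1 - p 1) - (q 1 - p 1) * (x 0 - p 0)) := by ring
  rw [this, hab, one_mul]

lemma plane_ext_height {a b : ℝ} (hab : a ^ 2 + b ^ 2 = 1) {x y : Plane}
    (h : height a b x = height a b y) (k : height (-b) a x = height (-b) a y) : x = y := by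
  unfold height at h k
  ext i
  fin_cases i
  · have : (a ^ 2 + b ^ 2) * x 0 = (a ^ 2 + b ^ 2) * y 0 := by linear_combination a * h - b * k
    simpa [hab] using this
  · have : (a ^ 2 + b ^ 2) * x 1 = (a ^ 2 + b ^ 2) * y 1 := by linear_combination b * h + a * k
    simpa [hab] using this

lemma convex_leftOf (p q : Plane) : Convex ℝ {x | LeftOf p q x} := by
  intro x hx y hy s t hs ht hst
  simp only [Set.mem_ofPred_eq, LeftOf, PiLp.add_apply, PiLp.smul_apply, smul_eq_mul] at *
  have hs' : s = 1 - t := by linarith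
  have := add_nonneg (mul_nonneg hs hx) (mul_nonneg ht hy)
  refine this.trans_eq ?_
  subst hs'
  ring

/-- Krein–Milman; the closure is superfluous because there are finitely many extreme points. -/
lemma convexHull_extremePoints_polygon (V : Finset Plane) :
    convexHull ℝ ((convexHull ℝ (V : Set Plane)).extremePoints ℝ) = convexHull ℝ (V : Set Plane) := by
  have hfin : ((convexHull ℝ (V : Set Plane)).extremePoints ℝ).Finite :=
    V.finite_toSet.subset extremePoints_convexHull_subset
  have := closure_convexHull_extremePoints
    (V.finite_toSet.isCompact_convexHull ℝ) (convex_convexHull ℝ (V : Set Plane))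
  rwa [(hfin.isClosed_convexHull ℝ).closure_eq] at this

/-! ### Edges crossed by a line -/

section Crossing

variable {a b : ℝ} {V : Finset Plane} {s : ℝ}

/-- A line through a polygon that avoids the vertices leaves it through an upward edge. -/
lemma exists_isEdge_crossing (hab : a ^ 2 + b ^ 2 = 1)
    (hs : s ∉ height a b '' (convexHull ℝ (V : Set Plane)).extremePoints ℝ)
    (hsQ : s ∈ height a b '' convexHull ℝ (V : Set Plane)) :
    ∃ e, IsEdge (convexHull ℝ (V : Set Plane)) e ∧ height a b e.1 < s ∧ s < height a b e.2 := by
  set Q := convexHull ℝ (V : Set Plane)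
  set E := Q.extremePoints ℝ
  have hE : convexHull ℝ E = Q := convexHull_extremePoints_polygon V
  have hfin : E.Finite := V.finite_toSet.subset extremePoints_convexHull_subset
  obtain ⟨y, hy, rfl⟩ := hsQ
  have hA : {v ∈ E | height a b v < height a b y}.Nonempty := by
    by_contra hne
    have : E ⊆ {w | height a b y < height a b w} := fun v hv => by
      by_contra hlt
      rw [Set.mem_ofPred_eq] at hlt
      rcases lt_or_eq_of_le (not_lt.mp hlt) with h | h
      · exact hne ⟨v, hv, h⟩
      · exact hs ⟨v, hv, h⟩
    have := convexHull_min this (convex_halfSpace_gt (isLinearMap_height a b) _)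
    rw [hE] at this
    exact lt_irrefl _ (Set.mem_ofPred.1 (this hy))
  have hB : {v ∈ E | height a b y < height a b v}.Nonempty := by
    by_contra hne
    have : E ⊆ {w | height a b w < height a b y} := fun v hv => by
      by_contra hlt
      rw [Set.mem_ofPred_eq] at hlt
      rcases lt_or_eq_of_le (not_lt.mp hlt) with h | h
      · exact hne ⟨v, hv, h⟩
      · exact hs ⟨v, hv, h.symm⟩
    have := convexHull_min this (convex_halfSpace_lt (isLinearMap_height a b) _)
    rw [hE] at this
    exact lt_irrefl _ (Set.mem_ofPred.1 (this hy))
  set s := height a b y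
  have hAf : {v ∈ E | height a b v < s}.Finite := hfin.subset (Set.sep_subset _ _)
  have hBf : {v ∈ E | s < height a b v}.Finite := hfin.subset (Set.sep_subset _ _)
  -- The quotient is the transversal coordinate at which the segment `pq` crosses level `s`. Among
  -- the pairs with one vertex below and one above, the rightmost crossing belongs to an edge.
  obtain ⟨⟨p, q⟩, ⟨⟨hpE, hp⟩, hqE, hq⟩, hmin⟩ := Set.exists_min_image _
    (fun e : Plane × Plane => (height (-b) a e.1 * (height a b e.2 - s) +
      height (-b) a e.2 * (s - height a b e.1)) / (height a b e.2 - height a b e.1))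
    (hAf.prod hBf) (hA.prod hB)
  simp only at hp hq hpE hqE hmin
  refine ⟨(p, q), ⟨hpE, hqE, fun h => ?_, ?_⟩, hp, hq⟩
  · simp only at h
    rw [h] at hp
    linarith
  · suffices h : E ⊆ {x | LeftOf p q x} by
      have := convexHull_min h (convex_leftOf p q)
      rw [hE] at this
      exact fun x hx => this hx
    intro v hv
    rw [Set.mem_ofPred_eq, leftOf_iff_height hab]
    rcases lt_trichotomy (height a b v) s with h | h | h
    · have := hmin (v, q) ⟨⟨hv, h⟩, hqE, hq⟩
      simp only at this
      rw [div_le_div_iff₀ (by linarith) (by linarith)] at this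
      refine (mul_nonneg_iff_of_pos_left (c := height a b q - s) (by linarith)).1 ?_
      linarith
    · exact absurd ⟨v, hv, h⟩ hs
    · have := hmin (p, v) ⟨⟨hpE, hp⟩, hv, h⟩
      simp only at this
      rw [div_le_div_iff₀ (by linarith) (by linarith)] at this
      refine (mul_nonneg_iff_of_pos_left (c := s - height a b p) (by linarith)).1 ?_
      linarith

/-- Two extreme points on the same open ray from a point of a convex set coincide. -/
lemma eq_of_extreme_of_ray {Q : Set Plane} (hab : a ^ 2 + b ^ 2 = 1) {p p' q : Plane}
    (hp : p ∈ Q.extremePoints ℝ) (hp' : p' ∈ Q.extremePoints ℝ) (hq : q ∈ Q)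
    (hpq : height a b p < height a b q) (hpq' : height a b p' < height a b q)
    (hcol : (height a b q - height a b p) * (height (-b) a p' - height (-b) a p) =
      (height (-b) a q - height (-b) a p) * (height a b p' - height a b p)) : p = p' := by
  wlog hle : height a b p ≤ height a b p' generalizing p p'
  · exact (this hp' hp hpq' hpq (by linarith) (by linarith)).symm
  rcases eq_or_lt_of_le hle with h | h
  · refine plane_ext_height hab h ?_
    have : (height a b q - height a b p) * (height (-b) a p' - height (-b) a p) = 0 := by
      rw [hcol, h]; ring
    rcases mul_eq_zero.mp this with h' | h' <;> linarith
  · have hd : 0 < height a b q - height a b p := by linarith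
    -- Collinearity and the order of heights put `p'` in the open segment from `p` to `q`, which
    -- extremality permits only if `p = p'`.
    refine hp'.2 hp.1 hq ⟨(height a b q - height a b p') / (height a b q - height a b p),
      (height a b p' - height a b p) / (height a b q - height a b p),
      div_pos (by linarith) hd, div_pos (by linarith) hd, by field_simp; ring, ?_⟩
    have L := isLinearMap_height a b
    have L' := isLinearMap_height (-b) a
    refine plane_ext_height hab ?_ ?_
    · rw [L.map_add, L.map_smul, L.map_smul]
      simp only [smul_eq_mul]
      field_simp
      ring
    · rw [L'.map_add, L'.map_smul, L'.map_smul]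
      simp only [smul_eq_mul]
      field_simp
      linear_combination -hcol

/-- The crossing point of each edge lies to the left of the other edge, so the crossing points
coincide. All four orientation inequalities are then equalities, the four endpoints are collinear,
and extremality identifies them. -/
lemma isEdge_crossing_unique {Q : Set Plane} (hab : a ^ 2 + b ^ 2 = 1) {e f : Plane × Plane}
    (he : IsEdge Q e) (he1 : height a b e.1 < s) (he2 : s < height a b e.2)
    (hf : IsEdge Q f) (hf1 : height a b f.1 < s) (hf2 : s < height a b f.2) : e = f := by
  obtain ⟨p, q⟩ := e
  obtain ⟨p', q'⟩ := f
  obtain ⟨hp, hq, -, hl⟩ := he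
  obtain ⟨hp', hq', -, hl'⟩ := hf
  simp only at *
  have h1 := (leftOf_iff_height hab _ _ _).1 (hl p' hp'.1)
  have h2 := (leftOf_iff_height hab _ _ _).1 (hl q' hq'.1)
  have h3 := (leftOf_iff_height hab _ _ _).1 (hl' p hp.1)
  have h4 := (leftOf_iff_height hab _ _ _).1 (hl' q hq.1)
  generalize hA : height a b p = A at *
  generalize hB : height a b q = B at *
  generalize hA' : height a b p' = A' at *
  generalize hB' : height a b q' = B' at *
  generalize hk : height (-b) a p = k at *
  generalize hl : height (-b) a q = l at *
  generalize hk' : height (-b) a p' = k' at *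
  generalize hl' : height (-b) a q' = l' at *
  -- The four nonnegative products `a1` to `a4` sum to zero: `a1 + a2` and `a3 + a4` are opposite
  -- multiples of the distance between the two crossing points.
  have e1 : (B - A) * (k' - k) - (l - k) * (A' - A) = 0 := by
    have a1 := mul_nonneg (sub_nonneg.2 hf2.le) h1
    have a2 := mul_nonneg (sub_nonneg.2 hf1.le) h2
    have a3 := mul_nonneg (sub_nonneg.2 he2.le) h3
    have a4 := mul_nonneg (sub_nonneg.2 he1.le) h4
    have hpos : 0 < B' - A' := by linarith
    have : (B' - s) * ((B - A) * (k' - k) - (l - k) * (A' - A)) = 0 := by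
      refine le_antisymm ?_ a1
      nlinarith
    rcases mul_eq_zero.mp this with h | h
    · linarith
    · exact h
  have e2 : (B - A) * (l' - k) - (l - k) * (B' - A) = 0 := by
    have a2 := mul_nonneg (sub_nonneg.2 hf1.le) h2
    have a3 := mul_nonneg (sub_nonneg.2 he2.le) h3
    have a4 := mul_nonneg (sub_nonneg.2 he1.le) h4
    have : (s - A') * ((B - A) * (l' - k) - (l - k) * (B' - A)) = 0 := by
      refine le_antisymm ?_ a2
      nlinarith
    rcases mul_eq_zero.mp this with h | h
    · linarith
    · exact h
  have hpp : p = p' := eq_of_extreme_of_ray hab hp hp' hq.1 (by linarith) (by linarith)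
    (by rw [hA, hB, hA', hk, hl, hk']; linarith)
  have hqq : q = q' := by
    -- Reversing the direction turns upper endpoints into lower ones.
    have hab' : (-a) ^ 2 + (-b) ^ 2 = 1 := by rw [← hab]; ring
    refine eq_of_extreme_of_ray hab' hq hq' hp.1 ?_ ?_ ?_
    · simp only [height_neg]; linarith
    · simp only [height_neg]; linarith
    · have e3 : ∀ y, height (- -b) (-a) y = -height (-b) a y := fun y => height_neg _ _ _
      rw [e3, e3, e3, height_neg, height_neg, height_neg, hA, hB, hB', hk, hl, hl']
      linear_combination -e2
  rw [hpp, hqq]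

/-- A line that avoids the vertices of a polygon and meets the polygon crosses exactly one upward
edge. -/
lemma tsum_isEdge_crossing (hab : a ^ 2 + b ^ 2 = 1)
    (hs : s ∉ height a b '' (convexHull ℝ (V : Set Plane)).extremePoints ℝ) :
    ∑' e : {e : Plane × Plane // IsEdge (convexHull ℝ (V : Set Plane)) e},
      (Set.Ioo (height a b e.1.1) (height a b e.1.2)).indicator (1 : ℝ → ENNReal) s =
      (height a b '' convexHull ℝ (V : Set Plane)).indicator 1 s := by
  by_cases hsQ : s ∈ height a b '' convexHull ℝ (V : Set Plane)
  · obtain ⟨e, he, h1, h2⟩ := exists_isEdge_crossing hab hs hsQ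
    rw [tsum_eq_single ⟨e, he⟩, Set.indicator_of_mem (by exact ⟨h1, h2⟩),
      Set.indicator_of_mem hsQ]
    · rintro ⟨f, hf⟩ hne
      refine Set.indicator_of_notMem (fun hmem => hne ?_) _
      exact Subtype.ext (isEdge_crossing_unique hab hf hmem.1 hmem.2 he h1 h2)
  · rw [Set.indicator_of_notMem hsQ, ENNReal.tsum_eq_zero]
    rintro ⟨f, hf⟩
    refine Set.indicator_of_notMem (fun hmem => hsQ ?_) _
    have hc : Convex ℝ (height a b '' convexHull ℝ (V : Set Plane)) :=
      (convex_convexHull ℝ _).is_linear_image (isLinearMap_height a b)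
    exact hc.ordConnected.out ⟨_, hf.1.1, rfl⟩ ⟨_, hf.2.1.1, rfl⟩ ⟨hmem.1.le, hmem.2.le⟩

end Crossing
-- Shadow lengths and Cauchy's formula
lemma dirSegment_eq_height (Q : Set Plane) (θ : ℝ) :
    dirSegment Q θ = height (Real.cos θ) (Real.sin θ) '' Q := rfl

/-- The length of the shadow of a polygon is the sum of the rises of its edges. -/
lemma tsum_isEdge_rise {a b : ℝ} (hab : a ^ 2 + b ^ 2 = 1) (V : Finset Plane) :
    ∑' e : {e : Plane × Plane // IsEdge (convexHull ℝ (V : Set Plane)) e},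
      ENNReal.ofReal (height a b e.1.2 - height a b e.1.1) =
      volume (height a b '' convexHull ℝ (V : Set Plane)) := by
  have hfin : ((convexHull ℝ (V : Set Plane)).extremePoints ℝ).Finite :=
    V.finite_toSet.subset extremePoints_convexHull_subset
  have : Countable {e : Plane × Plane // IsEdge (convexHull ℝ (V : Set Plane)) e} :=
    ((hfin.prod hfin).subset (fun e he => ⟨he.1, he.2.1⟩)).countable
  have hmeas : MeasurableSet (height a b '' convexHull ℝ (V : Set Plane)) :=
    ((V.finite_toSet.isCompact_convexHull ℝ).image (continuous_height a b)).measurableSet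
  rw [← lintegral_indicator_one hmeas]
  have h0 : ∀ᵐ s : ℝ, s ∉ height a b '' (convexHull ℝ (V : Set Plane)).extremePoints ℝ :=
    measure_eq_zero_iff_ae_notMem.1 ((hfin.image _).measure_zero _)
  -- Integrate the crossing count over `s`; only the heights of vertices, a null set, are excluded.
  -- Downward edges contribute empty intervals.
  rw [lintegral_congr_ae (h0.mono fun s hs => (tsum_isEdge_crossing hab hs).symm),
    lintegral_tsum fun e => (measurable_one.indicator measurableSet_Ioo).aemeasurable]
  refine tsum_congr fun e => ?_
  rw [lintegral_indicator_one measurableSet_Ioo, Real.volume_Ioo]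

lemma integral_abs_cos_sub (φ : ℝ) : ∫ θ in (0 : ℝ)..Real.pi, |Real.cos (θ - φ)| = 2 := by
  have hper : Function.Periodic (fun θ => |Real.cos θ|) Real.pi := fun θ => by
    simp [Real.cos_add_pi]
  rw [intervalIntegral.integral_comp_sub_right (fun θ => |Real.cos θ|)]
  have := hper.intervalIntegral_add_eq (0 - φ) (-(Real.pi / 2))
  rw [show 0 - φ + Real.pi = Real.pi - φ by ring,
    show -(Real.pi / 2) + Real.pi = Real.pi / 2 by ring] at this
  rw [this, intervalIntegral.integral_congr (g := Real.cos)]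
  · rw [integral_cos]; simp; norm_num
  · intro θ hθ
    rw [Set.uIcc_of_le (by linarith [Real.pi_pos])] at hθ
    exact abs_of_nonneg (Real.cos_nonneg_of_mem_Icc hθ)

/-- The mean length of the shadows of a segment. -/
lemma lintegral_abs_height_sub (p q : Plane) :
    ∫⁻ θ in Set.Ioc 0 Real.pi, ENNReal.ofReal
      |height (Real.cos θ) (Real.sin θ) q - height (Real.cos θ) (Real.sin θ) p| =
      2 * edist p q := by
  -- In polar coordinates of `q - p` the rise in direction `θ` is `‖z‖ * cos (θ - arg z)`.
  set z : ℂ := ⟨q 0 - p 0, q 1 - p 1⟩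
  have hz : ‖z‖ = dist p q := by
    rw [EuclideanSpace.dist_eq, Complex.norm_def, Complex.normSq_apply, Fin.sum_univ_two]
    congr 1
    simp only [z, Real.dist_eq, sq_abs]
    ring
  have hre : ‖z‖ * Real.cos z.arg = q 0 - p 0 := Complex.norm_mul_cos_arg z
  have him : ‖z‖ * Real.sin z.arg = q 1 - p 1 := Complex.norm_mul_sin_arg z
  have hval : ∀ θ, |height (Real.cos θ) (Real.sin θ) q - height (Real.cos θ) (Real.sin θ) p| =
      dist p q * |Real.cos (θ - z.arg)| := fun θ => by
    have h := abs_mul ‖z‖ (Real.cos (θ - z.arg))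
    rw [abs_of_nonneg (norm_nonneg z)] at h
    rw [← hz, ← h, Real.cos_sub]
    congr 1
    unfold height
    linear_combination -Real.cos θ * hre - Real.sin θ * him
  simp_rw [hval]
  have hint : IntegrableOn (fun θ => dist p q * |Real.cos (θ - z.arg)|) (Set.Ioc 0 Real.pi) := by
    have hc : Continuous fun θ => dist p q * |Real.cos (θ - z.arg)| := by fun_prop
    exact hc.integrableOn_Ioc
  rw [← ofReal_integral_eq_lintegral_ofReal hint (Filter.Eventually.of_forall fun θ =>
      mul_nonneg dist_nonneg (abs_nonneg _)),
    ← intervalIntegral.integral_of_le Real.pi_pos.le, intervalIntegral.integral_const_mul,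
    integral_abs_cos_sub, mul_comm, ENNReal.ofReal_mul (by norm_num), edist_dist]
  simp

lemma volume_image_height_neg (a b : ℝ) (Q : Set Plane) :
    volume (height (-a) (-b) '' Q) = volume (height a b '' Q) := by
  have : height (-a) (-b) '' Q = Neg.neg '' (height a b '' Q) := by
    rw [Set.image_image]
    exact Set.image_congr fun y _ => height_neg a b y
  rw [this, Set.image_neg_eq_neg, Measure.measure_neg]

/-- **Cauchy's formula** for polygons. -/
theorem perimeter_eq_lintegral (V : Finset Plane) :
    perimeter (convexHull ℝ (V : Set Plane)) =
      ∫⁻ θ in Set.Ioc 0 Real.pi, volume (dirSegment (convexHull ℝ (V : Set Plane)) θ) := by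
  have hfin : ((convexHull ℝ (V : Set Plane)).extremePoints ℝ).Finite :=
    V.finite_toSet.subset extremePoints_convexHull_subset
  have : Countable {e : Plane × Plane // IsEdge (convexHull ℝ (V : Set Plane)) e} :=
    ((hfin.prod hfin).subset (fun e he => ⟨he.1, he.2.1⟩)).countable
  -- Directions `θ` and `θ + π` have shadows of equal length; one collects the positive parts of the
  -- rises and the other the negative parts.
  have hpt : ∀ θ, 2 * volume (dirSegment (convexHull ℝ (V : Set Plane)) θ) =
      ∑' e : {e : Plane × Plane // IsEdge (convexHull ℝ (V : Set Plane)) e}, ENNReal.ofReal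
      |height (Real.cos θ) (Real.sin θ) e.1.2 - height (Real.cos θ) (Real.sin θ) e.1.1| := by
    intro θ
    have hab : Real.cos θ ^ 2 + Real.sin θ ^ 2 = 1 := Real.cos_sq_add_sin_sq θ
    have hab' : (-Real.cos θ) ^ 2 + (-Real.sin θ) ^ 2 = 1 := by rw [← hab]; ring
    rw [dirSegment_eq_height, two_mul]
    nth_rw 2 [← volume_image_height_neg]
    rw [← tsum_isEdge_rise hab, ← tsum_isEdge_rise hab', ← ENNReal.tsum_add]
    refine tsum_congr fun e => ?_
    rw [height_neg, height_neg]
    rcases le_total (height (Real.cos θ) (Real.sin θ) e.1.2)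
      (height (Real.cos θ) (Real.sin θ) e.1.1) with h | h
    · rw [abs_of_nonpos (by linarith), ENNReal.ofReal_of_nonpos (by linarith), zero_add]
      congr 1; ring
    · rw [abs_of_nonneg (by linarith)]
      nth_rw 2 [ENNReal.ofReal_of_nonpos (by linarith)]
      rw [add_zero]
  have hmeas : ∀ p q : Plane, Measurable fun θ => ENNReal.ofReal
      |height (Real.cos θ) (Real.sin θ) q - height (Real.cos θ) (Real.sin θ) p| := fun p q => by
    unfold height; fun_prop
  have h2 : 2 * perimeter (convexHull ℝ (V : Set Plane)) =
      2 * ∫⁻ θ in Set.Ioc 0 Real.pi, volume (dirSegment (convexHull ℝ (V : Set Plane)) θ) := by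
    rw [← lintegral_const_mul' _ _ (by simp), lintegral_congr hpt,
      lintegral_tsum fun e => (hmeas _ _).aemeasurable, perimeter, ← ENNReal.tsum_mul_left]
    exact tsum_congr fun e => (lintegral_abs_height_sub _ _).symm
  exact (ENNReal.mul_right_inj (by simp) (by simp)).1 h2

/-! ### Polytopes and half-spaces -/

/-- The intersection of a polytope with a half-space is a polytope. -/
lemma exists_finset_convexHull_inter_halfSpace {E : Type*} [AddCommGroup E] [Module ℝ E]
    (V : Finset E) (g : E →ₗ[ℝ] ℝ) (s : ℝ) :
    ∃ W : Finset E, {x ∈ convexHull ℝ (V : Set E) | g x - s ≤ 0} = convexHull ℝ (W : Set E) := by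
  classical
  set f : E → ℝ := fun x => g x - s with hf
  -- The new vertices are the old ones inside the half-space and, by `c`, the boundary points on
  -- segments from an inside to an outside vertex.
  set N := V.filter fun v => f v ≤ 0
  set P := V.filter fun v => ¬ f v ≤ 0
  set c : E × E → E := fun e =>
    (f e.2 / (f e.2 - f e.1)) • e.1 + (-f e.1 / (f e.2 - f e.1)) • e.2
  have hN : ∀ v ∈ N, v ∈ V ∧ f v ≤ 0 := fun v hv => by simpa [N] using hv
  have hP : ∀ v ∈ P, v ∈ V ∧ 0 < f v := fun v hv => by simpa [P] using hv
  refine ⟨N ∪ (N ×ˢ P).image c, Set.Subset.antisymm ?_ ?_⟩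
  · rintro x ⟨hx, hfx⟩
    obtain ⟨w, hw0, hw1, rfl⟩ := Finset.mem_convexHull'.1 hx
    set A := ∑ v ∈ N, w v * -f v with hA
    set B := ∑ v ∈ P, w v * f v with hB
    have hsplit : ∑ v ∈ N, w v + ∑ v ∈ P, w v = 1 := by
      rw [← hw1]; exact Finset.sum_filter_add_sum_filter_not V _ _
    have hsplit' : ∑ v ∈ N, w v • v + ∑ v ∈ P, w v • v = ∑ v ∈ V, w v • v :=
      Finset.sum_filter_add_sum_filter_not V _ _
    have hBA : B ≤ A := by
      have h1 : ∑ v ∈ N, w v * f v + ∑ v ∈ P, w v * f v = ∑ v ∈ V, w v * f v :=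
        Finset.sum_filter_add_sum_filter_not V _ _
      have h2 : ∑ v ∈ V, w v * f v = g (∑ v ∈ V, w v • v) - s := by
        simp only [hf, mul_sub, Finset.sum_sub_distrib, map_sum, map_smul, smul_eq_mul]
        rw [← Finset.sum_mul, hw1, one_mul]
      have h3 : ∑ v ∈ N, w v * f v = -A := by
        rw [hA, ← Finset.sum_neg_distrib]; exact Finset.sum_congr rfl fun _ _ => by ring
      linarith
    have hwN : ∀ v ∈ N, 0 ≤ w v := fun v hv => hw0 v (hN v hv).1
    have hwP : ∀ v ∈ P, 0 ≤ w v := fun v hv => hw0 v (hP v hv).1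
    have hB0 : 0 ≤ B := Finset.sum_nonneg fun v hv => mul_nonneg (hwP v hv) (hP v hv).2.le
    set H := convexHull ℝ ((N ∪ (N ×ˢ P).image c : Finset E) : Set E)
    have hcv : Convex ℝ H := convex_convexHull ℝ _
    have hNH : ∀ v ∈ N, v ∈ H := fun v hv => subset_convexHull ℝ _ (by simp [hv])
    have hcH : ∀ e ∈ N ×ˢ P, c e ∈ H := fun e he =>
      subset_convexHull ℝ _ (by
        rw [Finset.mem_coe, Finset.mem_union]
        exact Or.inr (Finset.mem_image_of_mem c he))
    rcases (hB0.trans hBA).eq_or_lt with hA0 | hApos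
    · have hP0 : ∀ v ∈ P, w v = 0 := fun v hv => by
        have h0 := (Finset.sum_eq_zero_iff_of_nonneg fun v hv =>
          mul_nonneg (hwP v hv) (hP v hv).2.le).1 (le_antisymm (hBA.trans hA0.ge) hB0) v hv
        exact (mul_eq_zero.1 h0).resolve_right (hP v hv).2.ne'
      rw [← hsplit', Finset.sum_eq_zero (s := P) fun v hv => by rw [hP0 v hv, zero_smul], add_zero]
      rw [Finset.sum_eq_zero (s := P) hP0, add_zero] at hsplit
      exact hcv.sum_mem hwN hsplit hNH
    · have hd : ∀ e ∈ N ×ˢ P, 0 < f e.2 - f e.1 := fun e he => by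
        have := Finset.mem_product.1 he
        linarith [(hN _ this.1).2, (hP _ this.2).2]
      -- A transport of mass: each outside vertex is paired with all inside vertices `v` in
      -- proportion to `w v * -f v`, whose total is `A`. This uses the fraction `B / A` of every
      -- inside weight and all outside weight.
      have key := hcv.sum_mem (t := N.disjSum (N ×ˢ P))
        (w := Sum.elim (fun v => w v * (1 - B / A))
          (fun e => w e.1 * w e.2 * (f e.2 - f e.1) / A)) (z := Sum.elim id c) ?_ ?_ ?_
      · convert key using 1
        rw [Finset.sum_disjSum]
        simp only [Sum.elim_inl, Sum.elim_inr, id]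
        have : ∀ e ∈ N ×ˢ P, (w e.1 * w e.2 * (f e.2 - f e.1) / A) • c e =
            (w e.1 * (w e.2 * f e.2) / A) • e.1 + (w e.2 * (w e.1 * -f e.1) / A) • e.2 := by
          intro e he
          have := (hd e he).ne'
          simp only [c, smul_add, smul_smul]
          congr 2 <;> field_simp
        rw [Finset.sum_congr rfl this, Finset.sum_add_distrib, Finset.sum_product,
          Finset.sum_product_right, ← hsplit', ← add_assoc, ← Finset.sum_add_distrib]
        congr 1
        · refine Finset.sum_congr rfl fun v _ => ?_
          simp only
          rw [← Finset.sum_smul, ← Finset.sum_div, ← Finset.mul_sum, ← add_smul]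
          congr 1
          field_simp
          ring
        · refine Finset.sum_congr rfl fun v _ => ?_
          simp only
          rw [← Finset.sum_smul, ← Finset.sum_div, ← Finset.mul_sum, ← hA,
            mul_div_cancel_right₀ _ hApos.ne']
      · rintro (v | e) he
        · rw [Finset.inl_mem_disjSum] at he
          have : B / A ≤ 1 := (div_le_one hApos).2 hBA
          exact mul_nonneg (hwN v he) (by linarith)
        · rw [Finset.inr_mem_disjSum] at he
          have := Finset.mem_product.1 he
          exact div_nonneg (mul_nonneg (mul_nonneg (hwN _ this.1) (hwP _ this.2)) (hd e he).le)
            hApos.le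
      · rw [Finset.sum_disjSum]
        simp only [Sum.elim_inl, Sum.elim_inr]
        have : ∀ e ∈ N ×ˢ P, w e.1 * w e.2 * (f e.2 - f e.1) / A =
            w e.1 * (w e.2 * f e.2) / A + w e.2 * (w e.1 * -f e.1) / A := fun e _ => by ring
        refine Eq.trans ?_ hsplit
        rw [Finset.sum_congr rfl this, Finset.sum_add_distrib, Finset.sum_product,
          Finset.sum_product_right, ← add_assoc, ← Finset.sum_add_distrib]
        congr 1
        · refine Finset.sum_congr rfl fun v _ => ?_
          simp only
          rw [← Finset.sum_div, ← Finset.mul_sum]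
          field_simp
          ring
        · refine Finset.sum_congr rfl fun v _ => ?_
          simp only
          rw [← Finset.sum_div, ← Finset.mul_sum, ← hA, mul_div_cancel_right₀ _ hApos.ne']
      · rintro (v | e) he
        · exact hNH v (Finset.inl_mem_disjSum.1 he)
        · exact hcH e (Finset.inr_mem_disjSum.1 he)
  · have hconv : Convex ℝ {x ∈ convexHull ℝ (V : Set E) | g x - s ≤ 0} := by
      have hh : Convex ℝ {x | g x - s ≤ 0} := by
        simpa only [sub_nonpos] using convex_halfSpace_le g.isLinear s
      exact (convex_convexHull ℝ (V : Set E)).inter hh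
    refine convexHull_min ?_ hconv
    intro x hx
    rw [Finset.mem_coe, Finset.mem_union, Finset.mem_image] at hx
    rcases hx with hx | ⟨e, he, rfl⟩
    · exact ⟨subset_convexHull ℝ _ (hN x hx).1, (hN x hx).2⟩
    · obtain ⟨h1, h2⟩ := Finset.mem_product.1 he
      have hv := hN _ h1
      have hu := hP _ h2
      have hd : 0 < f e.2 - f e.1 := by linarith
      refine ⟨(convex_convexHull ℝ (V : Set E)) (subset_convexHull ℝ _ hv.1)
        (subset_convexHull ℝ _ hu.1) (div_nonneg hu.2.le hd.le)
        (div_nonneg (by linarith) hd.le) (by field_simp; ring), ?_⟩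
      have h3 : g e.1 = f e.1 + s := by simp [hf]
      have h4 : g e.2 = f e.2 + s := by simp [hf]
      simp only [c, map_add, map_smul, smul_eq_mul, h3, h4]
      refine le_of_eq ?_
      field_simp
      ring

/-! ### Cuts -/

variable {d : ℕ}

/-- The projection onto a pair of dimensions as a linear map. -/
noncomputable def projₗ (p : DimPair d) : Space d →ₗ[ℝ] Plane where
  toFun := proj p
  map_add' x y := by ext i; fin_cases i <;> simp [proj]
  map_smul' c x := by ext i; fin_cases i <;> simp [proj]

lemma proj_zero (p : DimPair d) (x : Space d) : proj p x 0 = x p.1.1 := rfl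

lemma proj_one (p : DimPair d) (x : Space d) : proj p x 1 = x p.1.2 := rfl

lemma offset_eq_height (C : Cut d) (x : Space d) :
    C.offset x = height (Real.cos C.angle) (Real.sin C.angle) (proj C.1 x) - C.2.2 := by
  simp only [Cut.offset, Cut.pos, height]
  simp only [Matrix.cons_val_zero, Matrix.cons_val_one]
  linear_combination -C.2.2 * Real.cos_sq_add_sin_sq C.angle

lemma exists_linearMap_offset (C : Cut d) :
    ∃ g : Space d →ₗ[ℝ] ℝ, ∀ x, C.offset x = g x - C.2.2 :=
  ⟨((isLinearMap_height (Real.cos C.angle) (Real.sin C.angle)).mk' _).comp (projₗ C.1),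
    fun x => offset_eq_height C x⟩

lemma convex_offset_lt (C : Cut d) : Convex ℝ {x | C.offset x < 0} := by
  obtain ⟨g, hg⟩ := exists_linearMap_offset C
  simpa [hg] using convex_halfSpace_lt g.isLinear C.2.2

lemma convex_offset_gt (C : Cut d) : Convex ℝ {x | 0 < C.offset x} := by
  obtain ⟨g, hg⟩ := exists_linearMap_offset C
  simpa [hg] using convex_halfSpace_gt g.isLinear C.2.2

lemma convex_offset_le (C : Cut d) : Convex ℝ {x | C.offset x ≤ 0} := by
  obtain ⟨g, hg⟩ := exists_linearMap_offset C
  simpa [hg] using convex_halfSpace_le g.isLinear C.2.2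

/-- The cut with the same hyperplane whose sides are exchanged. -/
noncomputable def Cut.flip (C : Cut d) : Cut d := (C.1, C.2.1 + Real.pi, -C.2.2)

lemma offset_flip (C : Cut d) (x : Space d) : C.flip.offset x = -C.offset x := by
  rw [offset_eq_height, offset_eq_height]
  simp only [Cut.flip, Cut.angle, Real.cos_add_pi, Real.sin_add_pi]
  rw [height_neg]
  ring

lemma rightPart_eq_leftPart_flip (D : Set (Space d)) (C : Cut d) :
    rightPart D C = leftPart D C.flip := by
  ext x
  simp only [rightPart, leftPart, offset_flip, Left.neg_nonpos_iff]

/-- Joint continuity in cut and point is the source of all closed graphs below; the pair of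
dimensions is a discrete variable. -/
lemma continuous_offset : Continuous fun z : Cut d × Space d => z.1.offset z.2 := by
  have h1 : Continuous fun z : Cut d × Space d => z.2 z.1.1.1.1 :=
    (continuous_prod_of_discrete_left (f := fun q : DimPair d × Space d => q.2 q.1.1.1)).2
      (fun p => by simp only; fun_prop) |>.comp (by fun_prop : Continuous fun z : Cut d × Space d => (z.1.1, z.2))
  have h2 : Continuous fun z : Cut d × Space d => z.2 z.1.1.1.2 :=
    (continuous_prod_of_discrete_left (f := fun q : DimPair d × Space d => q.2 q.1.1.2)).2
      (fun p => by simp only; fun_prop) |>.comp (by fun_prop : Continuous fun z : Cut d × Space d => (z.1.1, z.2))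
  simp only [offset_eq_height, height, proj_zero, proj_one, Cut.angle]
  fun_prop

/-! ### Admissible domains -/

/-- The domains of the recursions: finite data sets and polytopes. -/
def Admissible (D : Set (Space d)) : Prop :=
  D.Finite ∨ ∃ V : Finset (Space d), D = convexHull ℝ (V : Set (Space d))

lemma Admissible.exists_convexHull_eq {D : Set (Space d)} (hD : Admissible D) :
    ∃ V : Finset (Space d), convexHull ℝ D = convexHull ℝ (V : Set (Space d)) := by
  rcases hD with h | ⟨V, rfl⟩
  · exact ⟨h.toFinset, by simp⟩
  · exact ⟨V, (convex_convexHull ℝ _).convexHull_eq⟩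

lemma Admissible.isCompact {D : Set (Space d)} (hD : Admissible D) : IsCompact D := by
  rcases hD with h | ⟨V, rfl⟩
  · exact h.isCompact
  · exact V.finite_toSet.isCompact_convexHull ℝ

lemma Admissible.leftPart {D : Set (Space d)} (hD : Admissible D) (C : Cut d) :
    Admissible (leftPart D C) := by
  rcases hD with h | ⟨V, rfl⟩
  · exact Or.inl (h.subset (Set.sep_subset _ _))
  · right
    obtain ⟨g, hg⟩ := exists_linearMap_offset C
    obtain ⟨W, hW⟩ := exists_finset_convexHull_inter_halfSpace V g C.2.2
    exact ⟨W, by simpa only [BSP.leftPart, hg] using hW⟩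

lemma Admissible.rightPart {D : Set (Space d)} (hD : Admissible D) (C : Cut d) :
    Admissible (rightPart D C) := by
  rw [rightPart_eq_leftPart_flip]; exact hD.leftPart _

/-! ### The cuts that meet a domain -/

/-- The cuts with points of `D` on both sides, i.e. the cuts that meet the convex hull of `D`. -/
def cutsMeeting (D : Set (Space d)) : Set (Cut d) :=
  {C | (leftPart D C).Nonempty ∧ (rightPart D C).Nonempty}

/-- A set strictly on one side of a hyperplane has its hull there too; conversely, a linear image of
the hull contains every value between two of its values. -/
lemma hyperplane_convexHull_nonempty_iff (D : Set (Space d)) (C : Cut d) :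
    (hyperplane (convexHull ℝ D) C).Nonempty ↔ C ∈ cutsMeeting D := by
  constructor
  · rintro ⟨x, hx, h0⟩
    constructor
    · by_contra hne
      have : D ⊆ {x | 0 < C.offset x} := fun y hy => by
        by_contra h
        exact hne ⟨y, hy, not_lt.1 h⟩
      have := Set.mem_ofPred.1 (convexHull_min this (convex_offset_gt C) hx)
      linarith
    · by_contra hne
      have : D ⊆ {x | C.offset x < 0} := fun y hy => by
        by_contra h
        exact hne ⟨y, hy, not_lt.1 h⟩
      have := Set.mem_ofPred.1 (convexHull_min this (convex_offset_lt C) hx)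
      linarith
  · rintro ⟨⟨x, hx, hx0⟩, y, hy, hy0⟩
    obtain ⟨g, hg⟩ := exists_linearMap_offset C
    have hc : Convex ℝ (g '' convexHull ℝ D) := (convex_convexHull ℝ D).linear_image g
    rw [hg] at hx0 hy0
    obtain ⟨z, hz, hz0⟩ := hc.ordConnected.out
      (Set.mem_image_of_mem g (subset_convexHull ℝ D hx))
      (Set.mem_image_of_mem g (subset_convexHull ℝ D hy))
      (show C.2.2 ∈ Set.Icc (g x) (g y) from ⟨by linarith, by linarith⟩)
    exact ⟨z, hz, by rw [hg, hz0, sub_self]⟩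

lemma cutsMeeting_eq (D : Set (Space d)) :
    cutsMeeting D = {C | (hyperplane (convexHull ℝ D) C).Nonempty} :=
  Set.ext fun C => (hyperplane_convexHull_nonempty_iff D C).symm

lemma cutsMeeting_mono {D D' : Set (Space d)} (h : D ⊆ convexHull ℝ D') :
    cutsMeeting D ⊆ cutsMeeting D' := by
  rw [cutsMeeting_eq, cutsMeeting_eq]
  rintro C ⟨x, hx, h0⟩
  exact ⟨x, convexHull_min h (convex_convexHull ℝ _) hx, h0⟩

/-! ### Closed families of domains -/

/-- A family of subsets of a compact set with closed graph. -/
def IsClosedFamily {X : Type*} [TopologicalSpace X] (D : X → Set (Space d)) : Prop :=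
  IsClosed {z : X × Space d | z.2 ∈ D z.1} ∧ ∃ K, IsCompact K ∧ ∀ x, D x ⊆ K

/-- Projection along a compact factor is a closed map. Sets of points carry no σ-algebra here, so
measurability in a domain is always tested along a closed family, where conditions such as
nonemptiness become closed. -/
lemma IsCompact.isClosed_exists_mem {X Y : Type*} [TopologicalSpace X] [TopologicalSpace Y]
    {K : Set Y} (hK : IsCompact K) {R : Set (X × Y)} (hR : IsClosed R) :
    IsClosed {x | ∃ y ∈ K, (x, y) ∈ R} := by
  have : CompactSpace K := isCompact_iff_compactSpace.1 hK
  have h : IsClosed ((fun z : X × K => (z.1, (z.2 : Y))) ⁻¹' R) := hR.preimage (by fun_prop)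
  convert isClosedMap_fst_of_compactSpace _ h using 1
  ext x
  simp

section Family

variable {X : Type*} [TopologicalSpace X] {D : X → Set (Space d)}

lemma isClosedFamily_const {K : Set (Space d)} (hK : IsCompact K) :
    IsClosedFamily fun _ : X => K :=
  ⟨hK.isClosed.preimage continuous_snd, K, hK, fun _ => subset_rfl⟩

lemma IsClosedFamily.comp (hD : IsClosedFamily D) {Y : Type*} [TopologicalSpace Y] {f : Y → X}
    (hf : Continuous f) : IsClosedFamily fun y => D (f y) :=
  ⟨hD.1.preimage (by fun_prop : Continuous fun z : Y × Space d => (f z.1, z.2)),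
    hD.2.imp fun _ h => ⟨h.1, fun y => h.2 (f y)⟩⟩

lemma IsClosedFamily.leftPart (hD : IsClosedFamily D) {C : X → Cut d} (hC : Continuous C) :
    IsClosedFamily fun x => leftPart (D x) (C x) := by
  refine ⟨hD.1.inter ?_, hD.2.imp fun _ h => ⟨h.1, fun x => (Set.sep_subset _ _).trans (h.2 x)⟩⟩
  exact isClosed_le (continuous_offset.comp
    (by fun_prop : Continuous fun z : X × Space d => (C z.1, z.2))) continuous_const

lemma continuous_flip : Continuous (Cut.flip : Cut d → Cut d) := by
  unfold Cut.flip; fun_prop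

lemma IsClosedFamily.rightPart (hD : IsClosedFamily D) {C : X → Cut d} (hC : Continuous C) :
    IsClosedFamily fun x => rightPart (D x) (C x) := by
  simp_rw [rightPart_eq_leftPart_flip]
  exact hD.leftPart (continuous_flip.comp hC)

lemma IsClosedFamily.isClosed_nonempty (hD : IsClosedFamily D) :
    IsClosed {x | (D x).Nonempty} := by
  obtain ⟨hc, K, hK, hsub⟩ := hD
  convert IsCompact.isClosed_exists_mem hK hc using 1
  ext x
  exact ⟨fun ⟨y, hy⟩ => ⟨y, hsub x hy, hy⟩, fun ⟨y, _, hy⟩ => ⟨y, hy⟩⟩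

lemma IsClosedFamily.isClosed_cutsMeeting (hD : IsClosedFamily D) :
    IsClosed {z : X × Cut d | z.2 ∈ cutsMeeting (D z.1)} :=
  ((hD.comp continuous_fst).leftPart continuous_snd).isClosed_nonempty.inter
    ((hD.comp continuous_fst).rightPart continuous_snd).isClosed_nonempty

end Family

lemma Admissible.measurableSet_cutsMeeting {D : Set (Space d)} (hD : Admissible D) :
    MeasurableSet (cutsMeeting D) :=
  ((isClosedFamily_const (X := Unit) hD.isCompact).isClosed_cutsMeeting.preimage
    (by fun_prop : Continuous fun C : Cut d => ((), C))).measurableSet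

/-! ### The law of a cut -/

/-- The invariant measure on lines of the plane. -/
noncomputable def lineMeasure : Measure (ℝ × ℝ) :=
  (volume.restrict (Set.Ioc 0 Real.pi)).prod volume

instance : SFinite lineMeasure := by unfold lineMeasure; infer_instance

/-- The measure on cuts with respect to which the generated cuts are uniform. -/
noncomputable def cutMeasure (d : ℕ) : Measure (Cut d) := Measure.count.prod lineMeasure

instance : SFinite (cutMeasure d) := by unfold cutMeasure; infer_instance

lemma cutMeasure_apply {B : Set (Cut d)} (hB : MeasurableSet B) :
    cutMeasure d B = ∑ p, lineMeasure (Prod.mk p ⁻¹' B) := by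
  rw [cutMeasure, Measure.prod_apply hB, lintegral_count, tsum_fintype]

/-- The lines that meet `Q`. -/
def linesMeeting (Q : Set Plane) : Set (ℝ × ℝ) := {z | z.2 ∈ dirSegment Q z.1}

lemma isClosed_linesMeeting {Q : Set Plane} (hQ : IsCompact Q) : IsClosed (linesMeeting Q) := by
  have h : IsClosed {w : (ℝ × ℝ) × Plane |
      height (Real.cos w.1.1) (Real.sin w.1.1) w.2 = w.1.2} :=
    isClosed_eq (by simp only [height]; fun_prop) (by fun_prop)
  exact IsCompact.isClosed_exists_mem hQ h

lemma linesMeeting_proj (D : Set (Space d)) (p : DimPair d) :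
    linesMeeting (proj p '' convexHull ℝ D) = Prod.mk p ⁻¹' cutsMeeting D := by
  ext ⟨θ, s⟩
  rw [cutsMeeting_eq]
  constructor
  · rintro ⟨_, ⟨x, hx, rfl⟩, h⟩
    refine ⟨x, hx, ?_⟩
    rw [offset_eq_height, sub_eq_zero]
    exact h
  · rintro ⟨x, hx, h⟩
    rw [offset_eq_height, sub_eq_zero] at h
    exact ⟨_, ⟨x, hx, rfl⟩, h⟩

lemma lineMeasure_linesMeeting {Q : Set Plane} (hQ : IsCompact Q) :
    lineMeasure (linesMeeting Q) = ∫⁻ θ in Set.Ioc 0 Real.pi, volume (dirSegment Q θ) := by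
  rw [lineMeasure, Measure.prod_apply (isClosed_linesMeeting hQ).measurableSet]
  rfl

lemma measurable_volume_dirSegment {Q : Set Plane} (hQ : IsCompact Q) :
    Measurable fun θ => volume (dirSegment Q θ) :=
  measurable_measure_prodMk_left (isClosed_linesMeeting hQ).measurableSet

/-- The density `|l_Q(θ)|` of the angle cancels the factor `1 / |l_Q(θ)|` of the uniform position,
so the line is uniform for `dθ ds` on the lines that meet `Q`. -/
lemma lineLaw_apply {Q : Set Plane} (hQ : IsCompact Q) {B : Set (ℝ × ℝ)} (hB : MeasurableSet B) :
    lineLaw Q B = (lineMeasure (linesMeeting Q))⁻¹ * lineMeasure (linesMeeting Q ∩ B) := by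
  have hL := (isClosed_linesMeeting hQ).measurableSet
  have happ : ∀ {B : Set (ℝ × ℝ)}, MeasurableSet B → ∀ θ,
      ((positionLaw Q θ).map fun s => (θ, s)) B =
        (volume (dirSegment Q θ))⁻¹ * volume (Prod.mk θ ⁻¹' (linesMeeting Q ∩ B)) := by
    intro B hB θ
    have hdir : MeasurableSet (dirSegment Q θ) := measurable_prodMk_left hL
    rw [Measure.map_apply (by fun_prop) hB, positionLaw, cond_apply hdir]
    rfl
  have hmeas : Measurable fun θ => (positionLaw Q θ).map fun s => (θ, s) := by
    refine Measure.measurable_of_measurable_coe _ fun B hB => ?_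
    simp_rw [happ hB]
    exact (measurable_volume_dirSegment hQ).inv.mul (measurable_measure_prodMk_left (hL.inter hB))
  have hmeasB : Measurable fun θ => ((positionLaw Q θ).map fun s => (θ, s)) B :=
    (Measure.measurable_coe hB).comp hmeas
  rw [lineLaw, Measure.bind_apply hB hmeas.aemeasurable, angleLaw, lintegral_smul_measure,
    ← lineMeasure_linesMeeting hQ, smul_eq_mul,
    lintegral_withDensity_eq_lintegral_mul _ (measurable_volume_dirSegment hQ)
      hmeasB]
  congr 1
  rw [lineMeasure, Measure.prod_apply (hL.inter hB)]
  refine lintegral_congr fun θ => ?_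
  simp only [Pi.mul_apply]
  rw [happ hB, ← mul_assoc]
  have hfin : volume (dirSegment Q θ) ≠ ⊤ :=
    (hQ.image (continuous_height _ _)).measure_lt_top.ne
  -- For a shadow of length zero the inverse is `⊤` and nothing cancels, but both sides vanish.
  by_cases h0 : volume (dirSegment Q θ) = 0
  · rw [h0, zero_mul, zero_mul]
    refine (measure_mono_null ?_ h0).symm
    exact fun s hs => hs.1
  · rw [ENNReal.mul_inv_cancel h0 hfin, one_mul]

lemma isCompact_proj_convexHull {D : Set (Space d)} (hD : Admissible D) (p : DimPair d) :
    IsCompact (proj p '' convexHull ℝ D) := by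
  obtain ⟨V, hV⟩ := hD.exists_convexHull_eq
  rw [hV]
  exact (V.finite_toSet.isCompact_convexHull ℝ).image
    (projₗ p).continuous_of_finiteDimensional

lemma perimeter_proj {D : Set (Space d)} (hD : Admissible D) (p : DimPair d) :
    perimeter (proj p '' convexHull ℝ D) = lineMeasure (Prod.mk p ⁻¹' cutsMeeting D) := by
  classical
  rw [← linesMeeting_proj, lineMeasure_linesMeeting (isCompact_proj_convexHull hD p)]
  obtain ⟨V, hV⟩ := hD.exists_convexHull_eq
  have : proj p '' convexHull ℝ D = convexHull ℝ ((V.image (proj p) : Finset Plane) : Set Plane) := by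
    rw [hV, Finset.coe_image]
    exact (projₗ p).image_convexHull _
  rw [this, perimeter_eq_lintegral]

/-- Cauchy's formula in each pair of dimensions turns the rate of the clock into a measure of cuts,
hence monotone and additive. -/
lemma totalPerimeter_eq {D : Set (Space d)} (hD : Admissible D) :
    totalPerimeter (convexHull ℝ D) = cutMeasure d (cutsMeeting D) := by
  rw [totalPerimeter, cutMeasure_apply hD.measurableSet_cutsMeeting]
  exact Finset.sum_congr rfl fun p _ => perimeter_proj hD p

lemma perimeter_ne_top (V : Finset Plane) : perimeter (convexHull ℝ (V : Set Plane)) ≠ ⊤ := by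
  have hfin : ((convexHull ℝ (V : Set Plane)).extremePoints ℝ).Finite :=
    V.finite_toSet.subset extremePoints_convexHull_subset
  have : Finite {e : Plane × Plane // IsEdge (convexHull ℝ (V : Set Plane)) e} :=
    ((hfin.prod hfin).subset (fun e he => ⟨he.1, he.2.1⟩)).to_subtype
  have := Fintype.ofFinite {e : Plane × Plane // IsEdge (convexHull ℝ (V : Set Plane)) e}
  rw [perimeter, tsum_fintype]
  exact (ENNReal.sum_lt_top.2 fun e _ => edist_lt_top _ _).ne

lemma cutMeasure_cutsMeeting_ne_top {D : Set (Space d)} (hD : Admissible D) :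
    cutMeasure d (cutsMeeting D) ≠ ⊤ := by
  classical
  rw [← totalPerimeter_eq hD, totalPerimeter]
  refine (ENNReal.sum_lt_top.2 fun p _ => ?_).ne
  obtain ⟨V, hV⟩ := hD.exists_convexHull_eq
  have : proj p '' convexHull ℝ D = convexHull ℝ ((V.image (proj p) : Finset Plane) : Set Plane) := by
    rw [hV, Finset.coe_image]
    exact (projₗ p).image_convexHull _
  rw [this]
  exact (perimeter_ne_top _).lt_top

/-- A generated cut is uniform on the cuts that meet the block. -/
theorem cutLaw_eq_cond {D : Set (Space d)} (hD : Admissible D) :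
    cutLaw (convexHull ℝ D) = cond (cutMeasure d) (cutsMeeting D) := by
  ext B hB
  have hmk : ∀ p : DimPair d, Measurable fun y : ℝ × ℝ => (p, y) := fun p => measurable_prodMk_left
  have hmeas : Measurable fun p : DimPair d =>
      (lineLaw (proj p '' convexHull ℝ D)).map fun y => (p, y) := measurable_of_countable _
  rw [cond_apply hD.measurableSet_cutsMeeting, cutLaw, Measure.bind_apply hB hmeas.aemeasurable,
    pairLaw, lintegral_finsetSum_measure,
    cutMeasure_apply (hD.measurableSet_cutsMeeting.inter hB), ← totalPerimeter_eq hD,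
    Finset.mul_sum]
  refine Finset.sum_congr rfl fun p _ => ?_
  rw [lintegral_smul_measure, lintegral_dirac, Measure.map_apply (hmk p) hB,
    lineLaw_apply (isCompact_proj_convexHull hD p) (hmk p hB), perimeter_proj hD,
    linesMeeting_proj, smul_eq_mul, Set.preimage_inter]
  by_cases h0 : lineMeasure (Prod.mk p ⁻¹' cutsMeeting D) = 0
  · rw [h0, measure_mono_null Set.inter_subset_left h0]
    simp
  · have hfin : lineMeasure (Prod.mk p ⁻¹' cutsMeeting D) ≠ ⊤ := by
      refine ne_top_of_le_ne_top (cutMeasure_cutsMeeting_ne_top hD) ?_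
      rw [cutMeasure_apply hD.measurableSet_cutsMeeting]
      exact Finset.single_le_sum (f := fun p => lineMeasure (Prod.mk p ⁻¹' cutsMeeting D))
        (fun _ _ => zero_le) (Finset.mem_univ p)
    rw [div_eq_mul_inv, mul_comm (lineMeasure _), mul_assoc, ← mul_assoc (lineMeasure _),
      ENNReal.mul_inv_cancel h0 hfin, one_mul]

/-- The total perimeter as a real number. -/
noncomputable def rate (D : Set (Space d)) : ℝ := (cutMeasure d (cutsMeeting D)).toReal

lemma rate_nonneg (D : Set (Space d)) : 0 ≤ rate D := ENNReal.toReal_nonneg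

lemma ofReal_rate {D : Set (Space d)} (hD : Admissible D) :
    ENNReal.ofReal (rate D) = cutMeasure d (cutsMeeting D) :=
  ENNReal.ofReal_toReal (cutMeasure_cutsMeeting_ne_top hD)

lemma rate_mono {D D' : Set (Space d)} (hD' : Admissible D') (h : D ⊆ convexHull ℝ D') :
    rate D ≤ rate D' :=
  ENNReal.toReal_mono (cutMeasure_cutsMeeting_ne_top hD') (measure_mono (cutsMeeting_mono h))

/-! ### Measurability on trees -/

namespace BinTree

variable {α : Type} [MeasurableSpace α]

/-- The first subtree (a leaf for a leaf). -/
def left : BinTree α → BinTree α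
  | .leaf => .leaf
  | .node _ l _ => l

/-- The second subtree (a leaf for a leaf). -/
def right : BinTree α → BinTree α
  | .leaf => .leaf
  | .node _ _ r => r

/-- The number of levels of inner nodes. -/
def depth : BinTree α → ℕ
  | .leaf => 0
  | .node _ l r => max l.depth r.depth + 1

lemma measurable_label (w : List Bool) : Measurable fun t : BinTree α => t.label w :=
  (measurable_pi_apply w).comp (comap_measurable _)

lemma measurable_iff_label {Y : Type*} [MeasurableSpace Y] {f : Y → BinTree α} :
    Measurable f ↔ ∀ w, Measurable fun y => (f y).label w :=
  measurable_comap_iff.trans measurable_pi_iff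

lemma measurable_node :
    Measurable fun z : α × BinTree α × BinTree α => BinTree.node z.1 z.2.1 z.2.2 := by
  refine measurable_iff_label.2 fun w => ?_
  rcases w with _ | ⟨b, w⟩
  · exact measurable_inr.comp measurable_fst
  · cases b
    · exact (measurable_label w).comp (measurable_fst.comp measurable_snd)
    · exact (measurable_label w).comp (measurable_snd.comp measurable_snd)

lemma measurable_left : Measurable (left : BinTree α → BinTree α) := by
  refine measurable_iff_label.2 fun w => ?_
  convert measurable_label (α := α) (false :: w) using 2 with t
  cases t <;> rfl

lemma measurable_right : Measurable (right : BinTree α → BinTree α) := by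
  refine measurable_iff_label.2 fun w => ?_
  convert measurable_label (α := α) (true :: w) using 2 with t
  cases t <;> rfl

lemma measurableSet_leaf : MeasurableSet {(leaf : BinTree α)} := by
  convert measurable_label (α := α) [] (measurableSet_range_inl) using 1
  ext t
  cases t <;> simp [label]

/-- A function on trees is measurable if it is measurable on leaves and on nodes. -/
lemma measurable_of_leaf_of_node {Y Z : Type*} [MeasurableSpace Y] [MeasurableSpace Z]
    {F : BinTree α × Y → Z} (h0 : Measurable fun y => F (leaf, y))
    (h1 : Measurable fun w : (α × BinTree α × BinTree α) × Y =>
      F (node w.1.1 w.1.2.1 w.1.2.2, w.2)) : Measurable F := by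
  classical
  rcases isEmpty_or_nonempty α with hα | ⟨⟨a₀⟩⟩
  · convert h0.comp (measurable_snd : Measurable (Prod.snd : BinTree α × Y → Y)) using 1
    ext ⟨t, y⟩
    cases t with
    | leaf => rfl
    | node a l r => exact hα.elim a
  -- The default label `a₀` is only read at a leaf, where the other branch of `hF` applies.
  · set root : BinTree α → α := fun t => (t.label []).elim (fun _ => a₀) id with hroot
    have hrootm : Measurable root :=
      (Measurable.sumElim measurable_const measurable_id).comp (measurable_label [])
    have hF : F = fun z => if z.1 ∈ ({leaf} : Set (BinTree α)) then F (leaf, z.2)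
        else F (node (root z.1) z.1.left z.1.right, z.2) := by
      ext ⟨t, y⟩
      cases t with
      | leaf => simp
      | node a l r => simp [hroot, label, left, right]
    rw [hF]
    refine Measurable.ite (measurable_fst measurableSet_leaf) (h0.comp measurable_snd)
      (h1.comp (f := fun z : BinTree α × Y => ((root z.1, z.1.left, z.1.right), z.2)) ?_)
    exact ((hrootm.comp measurable_fst).prodMk ((measurable_left.comp measurable_fst).prodMk
      (measurable_right.comp measurable_fst))).prodMk measurable_snd

end BinTree

/-! ### Measurability of the restriction -/

/-- The restriction of a tree to the convex hulls of a domain. -/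
noncomputable abbrev restrictHull (t : CutTree d) (D : Set (Space d)) (a : ℝ) : CutTree d :=
  restrictFrom (fun A => convexHull ℝ A) t D a

open Classical in
-- A missed domain lies strictly on one side, so the test `leftPart D C = D` can be replaced by
-- emptiness of the right part, a condition whose measurability is visible. An empty domain goes
-- left in both forms.
lemma restrictHull_node (c : ℝ) (C : Cut d) (l r : CutTree d) (D : Set (Space d)) (a : ℝ) :
    restrictHull (.node (c, C) l r) D a =
      if C ∈ cutsMeeting D then
        .node (a + c, C) (restrictHull l (leftPart D C) 0) (restrictHull r (rightPart D C) 0)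
      else if (rightPart D C).Nonempty then restrictHull r D (a + c)
      else restrictHull l D (a + c) := by
  rw [restrictHull, restrictFrom, ← hyperplane_convexHull_nonempty_iff]
  by_cases h : (hyperplane (convexHull ℝ D) C).Nonempty
  · simp only [if_pos h]
  simp only [if_neg h]
  rw [hyperplane_convexHull_nonempty_iff] at h
  by_cases hr : (rightPart D C).Nonempty
  · rw [if_pos hr, if_neg]
    intro hl
    obtain ⟨x, hx⟩ := hr
    exact h ⟨⟨x, hl.symm.subset hx.1⟩, x, hx⟩
  · rw [if_neg hr, if_pos]
    refine Set.Subset.antisymm (Set.sep_subset _ _) fun x hx => ⟨hx, ?_⟩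
    by_contra h0
    exact hr ⟨x, hx, (not_le.1 h0).le⟩

open Classical in
/-- The restriction, with everything below the first `n` levels of the tree discarded. -/
noncomputable def restrictUpTo : ℕ → CutTree d → Set (Space d) → ℝ → CutTree d
  | 0, _, _, _ => .leaf
  | _ + 1, .leaf, _, _ => .leaf
  | n + 1, .node (c, C) l r, D, a =>
    if C ∈ cutsMeeting D then
      .node (a + c, C) (restrictUpTo n l (leftPart D C) 0) (restrictUpTo n r (rightPart D C) 0)
    else if (rightPart D C).Nonempty then restrictUpTo n r D (a + c)
    else restrictUpTo n l D (a + c)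

lemma restrictUpTo_eq (n : ℕ) : ∀ (t : CutTree d) (D : Set (Space d)) (a : ℝ), t.depth ≤ n →
    restrictUpTo n t D a = restrictHull t D a := by
  induction n with
  | zero =>
    intro t D a ht
    cases t with
    | leaf => rfl
    | node => simp [BinTree.depth] at ht
  | succ n ih =>
    intro t D a ht
    cases t with
    | leaf => rfl
    | node cC l r =>
      obtain ⟨c, C⟩ := cC
      have hl : l.depth ≤ n := by simp only [BinTree.depth] at ht; omega
      have hr : r.depth ≤ n := by simp only [BinTree.depth] at ht; omega
      rw [restrictHull_node, restrictUpTo, ih _ _ _ hl, ih _ _ _ hr, ih _ _ _ hl, ih _ _ _ hr]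

/-- A kept cut makes the next domains depend on it, so the induction must range over all parameter
spaces and passes from `X` to `X × Cut d`. -/
lemma measurable_restrictUpTo (n : ℕ) : ∀ (X : Type) [TopologicalSpace X]
    [SecondCountableTopology X] [MeasurableSpace X] [BorelSpace X] (D : X → Set (Space d)),
    IsClosedFamily D →
    Measurable fun z : CutTree d × X × ℝ => restrictUpTo n z.1 (D z.2.1) z.2.2 := by
  induction n with
  | zero => intros; exact measurable_const
  | succ n ih =>
    intro X _ _ _ _ D hD
    refine BinTree.measurable_of_leaf_of_node measurable_const ?_
    have hxC : Measurable fun w : ((ℝ × Cut d) × CutTree d × CutTree d) × X × ℝ =>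
        (w.2.1, w.1.1.2) := by fun_prop
    simp only [restrictUpTo]
    refine Measurable.ite ?_ (BinTree.measurable_node.comp (Measurable.prodMk (by fun_prop)
      (Measurable.prodMk ?_ ?_))) (Measurable.ite ?_ ?_ ?_)
    · exact hxC hD.isClosed_cutsMeeting.measurableSet
    · exact (ih (X × Cut d) _ ((hD.comp continuous_fst).leftPart continuous_snd)).comp
        (f := fun w : ((ℝ × Cut d) × CutTree d × CutTree d) × X × ℝ => (w.1.2.1, (w.2.1, w.1.1.2), 0)) (by fun_prop)
    · exact (ih (X × Cut d) _ ((hD.comp continuous_fst).rightPart continuous_snd)).comp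
        (f := fun w : ((ℝ × Cut d) × CutTree d × CutTree d) × X × ℝ => (w.1.2.2, (w.2.1, w.1.1.2), 0)) (by fun_prop)
    · exact hxC ((hD.comp continuous_fst).rightPart
        continuous_snd).isClosed_nonempty.measurableSet
    · exact (ih X D hD).comp (f := fun w : ((ℝ × Cut d) × CutTree d × CutTree d) × X × ℝ => (w.1.2.2, w.2.1, w.2.2 + w.1.1.1)) (by fun_prop)
    · exact (ih X D hD).comp (f := fun w : ((ℝ × Cut d) × CutTree d × CutTree d) × X × ℝ => (w.1.2.1, w.2.1, w.2.2 + w.1.1.1)) (by fun_prop)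

/-- Since the approximations stabilise pointwise, no topology on the target is needed. -/
lemma measurable_of_eventually_eq {Y Z : Type*} [MeasurableSpace Y] [MeasurableSpace Z]
    {f : Y → Z} {g : ℕ → Y → Z} (hg : ∀ n, Measurable (g n))
    (h : ∀ y, ∃ N, ∀ n, N ≤ n → g n y = f y) : Measurable f := by
  intro B hB
  have : f ⁻¹' B = ⋃ N, ⋂ n ≥ N, g n ⁻¹' B := by
    ext y
    obtain ⟨N, hN⟩ := h y
    simp only [Set.mem_preimage, Set.mem_iUnion, Set.mem_iInter]
    constructor
    · exact fun hy => ⟨N, fun n hn => by rwa [hN n hn]⟩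
    · rintro ⟨M, hM⟩
      rw [← hN _ (le_max_left N M)]
      exact hM _ (le_max_right N M)
  rw [this]
  exact .iUnion fun N => .iInter fun n => .iInter fun _ => hg n hB

lemma measurable_restrictHull {D : Set (Space d)} (hD : IsCompact D) (a : ℝ) :
    Measurable fun t : CutTree d => restrictHull t D a :=
  measurable_of_eventually_eq
    (fun n => (measurable_restrictUpTo n Unit (fun _ => D) (isClosedFamily_const hD)).comp
      (f := fun t => (t, (), a)) (by fun_prop))
    fun t => ⟨t.depth, fun n hn => restrictUpTo_eq n t D a hn⟩

/-- Adding `a` to the cost of the first cut of a tree. -/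
def shift (a : ℝ) : CutTree d → CutTree d
  | .leaf => .leaf
  | .node (c, C) l r => .node (a + c, C) l r

lemma measurable_shift (a : ℝ) : Measurable (shift a : CutTree d → CutTree d) := by
  have : Measurable fun z : CutTree d × Unit => shift a z.1 := by
    refine BinTree.measurable_of_leaf_of_node measurable_const ?_
    exact BinTree.measurable_node.comp
      (f := fun w : ((ℝ × Cut d) × CutTree d × CutTree d) × Unit =>
        ((a + w.1.1.1, w.1.1.2), w.1.2.1, w.1.2.2)) (by fun_prop)
  exact this.comp (f := fun t => (t, ())) (by fun_prop)

/-- Skipped costs enter only the first cut kept. -/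
lemma restrictHull_eq_shift (t : CutTree d) (D : Set (Space d)) (a : ℝ) :
    restrictHull t D a = shift a (restrictHull t D 0) := by
  induction t generalizing D a with
  | leaf => rfl
  | node cC l r ihl ihr =>
    obtain ⟨c, C⟩ := cC
    have hshift : ∀ t : CutTree d, shift (a + c) t = shift a (shift c t) := by
      intro t
      cases t with
      | leaf => rfl
      | node => simp [shift, add_assoc]
    rw [restrictHull_node, restrictHull_node]
    split_ifs
    · simp [shift]
    · rw [ihr, ihr D (0 + c), zero_add, hshift]
    · rw [ihl, ihl D (0 + c), zero_add, hshift]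

/-! ### Exponential integrals and memorylessness -/

lemma setLIntegral_exp {k x : ℝ} (hk : 0 ≤ k) (hx : 0 ≤ x) :
    ∫⁻ c in Set.Ico 0 x, ENNReal.ofReal (k * Real.exp (-(k * c))) =
      ENNReal.ofReal (1 - Real.exp (-(k * x))) := by
  have hc : Continuous fun c => k * Real.exp (-(k * c)) := by fun_prop
  have hderiv : ∀ c ∈ Set.uIcc 0 x, HasDerivAt (fun c => -Real.exp (-(k * c)))
      (k * Real.exp (-(k * c))) c := fun c _ => hasDerivAt_neg_exp_mul_exp
  rw [Measure.restrict_congr_set Ico_ae_eq_Ioc, ← ofReal_integral_eq_lintegral_ofReal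
      hc.integrableOn_Ioc (Filter.Eventually.of_forall fun c => by positivity),
    ← intervalIntegral.integral_of_le hx,
    intervalIntegral.integral_eq_sub_of_hasDerivAt hderiv (hc.intervalIntegrable _ _)]
  congr 1
  simp
  ring

lemma setLIntegral_exp_add {k x : ℝ} (hk : 0 ≤ k) (hx : 0 ≤ x) :
    (∫⁻ c in Set.Ico 0 x, ENNReal.ofReal (k * Real.exp (-(k * c)))) +
      ENNReal.ofReal (Real.exp (-(k * x))) = 1 := by
  have : Real.exp (-(k * x)) ≤ 1 := Real.exp_le_one_iff.2 (by have := mul_nonneg hk hx; linarith)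
  rw [setLIntegral_exp hk hx, ← ENNReal.ofReal_add (by linarith) (Real.exp_pos _).le]
  simp

/-- Integration of a function that is constant beyond `τ` against an exponential law. -/
lemma lintegral_expMeasure_ite {r τ : ℝ} (hr : 0 < r) {G : ℝ → ENNReal} (hG : Measurable G)
    (l : ENNReal) :
    ∫⁻ c, (if c < τ then G c else l) ∂expMeasure r =
      (∫⁻ c in Set.Ico 0 τ, ENNReal.ofReal (r * Real.exp (-(r * c))) * G c) +
        ENNReal.ofReal (Real.exp (-(r * max τ 0))) * l := by
  have hpdf : Measurable (exponentialPDF r) := (measurable_exponentialPDFReal r).ennreal_ofReal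
  -- With the clamp, one formula covers negative budgets, for which the procedure stops at once.
  set x := max τ 0
  have hx : 0 ≤ x := le_max_right _ _
  have hm : Measurable fun c => if c < τ then G c else l :=
    Measurable.ite measurableSet_Iio hG measurable_const
  have h1 : ∫⁻ c, (if c < τ then G c else l) ∂expMeasure r =
      ∫⁻ c, exponentialPDF r c * (if c < τ then G c else l) :=
    lintegral_withDensity_eq_lintegral_mul _ hpdf hm
  have h2 : ∫⁻ c in Set.Iio 0, exponentialPDF r c * (if c < τ then G c else l) = 0 := by
    rw [setLIntegral_congr_fun (g := fun _ => 0) measurableSet_Iio, lintegral_zero]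
    intro c hc
    simp only [exponentialPDF_of_neg hc, zero_mul]
  have h3 : ∫⁻ c in Set.Ici x, exponentialPDF r c = ENNReal.ofReal (Real.exp (-(r * x))) := by
    have hle : Real.exp (-(r * x)) ≤ 1 :=
      Real.exp_le_one_iff.2 (by have := mul_nonneg hr.le hx; linarith)
    have h := lintegral_add_compl (μ := volume) (exponentialPDF r) (measurableSet_Iic (a := x))
    rw [lintegral_exponentialPDF_eq_one hr, lintegral_exponentialPDF_eq_antiDeriv hr, if_pos hx,
      Set.compl_Iic] at h
    rw [Measure.restrict_congr_set Ioi_ae_eq_Ici.symm]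
    refine (ENNReal.add_right_inj (ENNReal.ofReal_ne_top (r := 1 - Real.exp (-(r * x))))).1 ?_
    rw [h, ← ENNReal.ofReal_add (by linarith) (Real.exp_pos _).le]
    simp
  have h4 : Set.Ico (0 : ℝ) τ = Set.Ico 0 x := by
    rcases le_total τ 0 with h | h
    · rw [Set.Ico_eq_empty (by linarith), show x = 0 from max_eq_right h, Set.Ico_self]
    · rw [show x = τ from max_eq_left h]
  rw [h1, ← lintegral_add_compl _ (measurableSet_Iio (a := (0 : ℝ))), h2, zero_add, Set.compl_Iio,
    ← Set.Ico_union_Ici_eq_Ici hx, lintegral_union measurableSet_Ici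
      (Set.disjoint_left.2 fun c hc hc' => not_lt.2 (Set.mem_Ici.1 hc') hc.2), h4]
  congr 1
  · refine setLIntegral_congr_fun measurableSet_Ico fun c hc => ?_
    have : c < τ := by
      rw [← h4] at hc
      exact hc.2
    simp only [if_pos this, exponentialPDF_of_nonneg hc.1]
  · rw [← h3, ← lintegral_mul_const _ hpdf]
    refine setLIntegral_congr_fun measurableSet_Ici fun c hc => ?_
    rw [if_neg (not_lt.2 ((le_max_left _ _).trans (Set.mem_Ici.1 hc)))]

lemma setLIntegral_Ico_sub (φ : ℝ → ENNReal) (c τ : ℝ) :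
    ∫⁻ b in Set.Ico 0 (τ - c), φ b = ∫⁻ e in Set.Ico c τ, φ (e - c) := by
  rw [← lintegral_indicator measurableSet_Ico, ← lintegral_indicator measurableSet_Ico,
    ← lintegral_sub_right_eq_self _ c]
  refine lintegral_congr fun e => ?_
  by_cases h : e ∈ Set.Ico c τ
  · rw [Set.indicator_of_mem h, Set.indicator_of_mem]
    exact ⟨by linarith [h.1], by linarith [h.2]⟩
  · rw [Set.indicator_of_notMem h, Set.indicator_of_notMem]
    exact fun h' => h ⟨by linarith [h'.1], by linarith [h'.2]⟩

/-- Tonelli on the triangle `0 ≤ c ≤ e < τ`; its diagonal is negligible, which allows `Ico 0 e` in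
place of `Icc 0 e`. -/
lemma setLIntegral_Ico_swap {f : ℝ → ℝ → ENNReal} (hf : Measurable (Function.uncurry f)) (τ : ℝ) :
    ∫⁻ c in Set.Ico 0 τ, ∫⁻ e in Set.Ico c τ, f c e =
      ∫⁻ e in Set.Ico 0 τ, ∫⁻ c in Set.Ico 0 e, f c e := by
  have hS : MeasurableSet {z : ℝ × ℝ | 0 ≤ z.1 ∧ z.1 ≤ z.2 ∧ z.2 < τ} :=
    (measurableSet_le measurable_const measurable_fst).inter
      ((measurableSet_le measurable_fst measurable_snd).inter
        (measurableSet_lt measurable_snd measurable_const))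
  set S : Set (ℝ × ℝ) := {z : ℝ × ℝ | 0 ≤ z.1 ∧ z.1 ≤ z.2 ∧ z.2 < τ}
  have h1 : ∫⁻ c in Set.Ico 0 τ, ∫⁻ e in Set.Ico c τ, f c e =
      ∫⁻ c, ∫⁻ e, S.indicator (Function.uncurry f) (c, e) := by
    rw [← lintegral_indicator measurableSet_Ico]
    refine lintegral_congr fun c => ?_
    by_cases hc : c ∈ Set.Ico 0 τ
    · rw [Set.indicator_of_mem hc, ← lintegral_indicator measurableSet_Ico]
      refine lintegral_congr fun e => ?_
      by_cases he : e ∈ Set.Ico c τ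
      · rw [Set.indicator_of_mem he, Set.indicator_of_mem (show (c, e) ∈ S from ⟨hc.1, he⟩)]
        rfl
      · rw [Set.indicator_of_notMem he, Set.indicator_of_notMem (fun h : (c, e) ∈ S => he h.2)]
    · rw [Set.indicator_of_notMem hc]
      symm
      rw [lintegral_eq_zero_of_ae_eq_zero]
      refine Filter.Eventually.of_forall fun e => Set.indicator_of_notMem (fun h : (c, e) ∈ S => ?_) _
      exact hc ⟨h.1, h.2.1.trans_lt h.2.2⟩
  have h2 : ∫⁻ e in Set.Ico 0 τ, ∫⁻ c in Set.Ico 0 e, f c e =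
      ∫⁻ e, ∫⁻ c, S.indicator (Function.uncurry f) (c, e) := by
    rw [← lintegral_indicator measurableSet_Ico]
    refine lintegral_congr fun e => ?_
    by_cases he : e ∈ Set.Ico 0 τ
    · rw [Set.indicator_of_mem he, Measure.restrict_congr_set Ico_ae_eq_Icc,
        ← lintegral_indicator measurableSet_Icc]
      refine lintegral_congr fun c => ?_
      by_cases hc : c ∈ Set.Icc 0 e
      · rw [Set.indicator_of_mem hc,
          Set.indicator_of_mem (show (c, e) ∈ S from ⟨hc.1, hc.2, he.2⟩)]
        rfl
      · rw [Set.indicator_of_notMem hc,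
          Set.indicator_of_notMem (fun h : (c, e) ∈ S => hc ⟨h.1, h.2.1⟩)]
    · rw [Set.indicator_of_notMem he]
      symm
      rw [lintegral_eq_zero_of_ae_eq_zero]
      refine Filter.Eventually.of_forall fun c => Set.indicator_of_notMem (fun h : (c, e) ∈ S => ?_) _
      exact he ⟨h.1.trans h.2.1, h.2.2⟩
  rw [h1, h2]
  exact lintegral_lintegral_swap (hf.indicator hS).aemeasurable

/-- Memorylessness: an exponential clock of rate `m` may be simulated by a clock of a higher rate
`M` that is restarted after each of its rings with probability `(M - m) / M`. -/
lemma exponential_thinning {M m τ : ℝ} (hmM : m ≤ M) {g : ℝ → ENNReal}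
    (hg : Measurable g) (l : ENNReal) :
    (∫⁻ c in Set.Ico 0 τ, ENNReal.ofReal (Real.exp (-(M * c))) *
        (g c + ENNReal.ofReal (M - m) *
          ((∫⁻ b in Set.Ico 0 (τ - c), ENNReal.ofReal (Real.exp (-(m * b))) * g (c + b)) +
            ENNReal.ofReal (Real.exp (-(m * max (τ - c) 0))) * l))) +
        ENNReal.ofReal (Real.exp (-(M * max τ 0))) * l =
      (∫⁻ c in Set.Ico 0 τ, ENNReal.ofReal (Real.exp (-(m * c))) * g c) +
        ENNReal.ofReal (Real.exp (-(m * max τ 0))) * l := by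
  rcases lt_or_ge τ 0 with hτ | hτ
  · rw [Set.Ico_eq_empty (by linarith), max_eq_right hτ.le]
    simp
  set k := M - m with hk
  have hk0 : 0 ≤ k := by linarith
  set x : ℝ → ENNReal := fun c => ENNReal.ofReal (Real.exp (-(m * c)))
  have hxm : Measurable x := by fun_prop
  set y : ℝ → ENNReal := fun c => ENNReal.ofReal (k * Real.exp (-(k * c)))
  have hym : Measurable y := by fun_prop
  have hMx : ∀ c, ENNReal.ofReal (Real.exp (-(M * c))) =
      x c * ENNReal.ofReal (Real.exp (-(k * c))) := fun c => by
    rw [← ENNReal.ofReal_mul (Real.exp_pos _).le, ← Real.exp_add]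
    congr 2; rw [hk]; ring
  -- In the absolute time `e = c + b`, the weight `exp (-M c) * k * exp (-m (e - c))` factors as `y
  -- c * x e`: a first rejection at `c` times survival of the clock of rate `m`.
  have hA : ∀ c ∈ Set.Ico 0 τ, ENNReal.ofReal (Real.exp (-(M * c))) * (g c + ENNReal.ofReal k *
        ((∫⁻ b in Set.Ico 0 (τ - c), x b * g (c + b)) + x (max (τ - c) 0) * l)) =
      ENNReal.ofReal (Real.exp (-(M * c))) * g c + (∫⁻ e in Set.Ico c τ, y c * (x e * g e)) +
        y c * (x τ * l) := by
    intro c hc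
    rw [max_eq_left (by linarith [hc.2]), setLIntegral_Ico_sub, mul_add, ← mul_assoc _ _ (_ + _),
      mul_add, ← add_assoc, ← mul_assoc _ (x (τ - c))]
    have hyx : ∀ e, ENNReal.ofReal (Real.exp (-(M * c))) * ENNReal.ofReal k * x (e - c) =
        y c * x e := fun e => by
      rw [← ENNReal.ofReal_mul (Real.exp_pos _).le, ← ENNReal.ofReal_mul (by positivity),
        ← ENNReal.ofReal_mul (by positivity)]
      congr 1
      have : Real.exp (-(M * c)) * Real.exp (-(m * (e - c))) =
          Real.exp (-(k * c)) * Real.exp (-(m * e)) := by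
        rw [← Real.exp_add, ← Real.exp_add]; congr 1; rw [hk]; ring
      linear_combination k * this
    rw [hyx, mul_assoc (y c)]
    congr 2
    rw [← lintegral_const_mul _ (by fun_prop)]
    refine lintegral_congr fun e => ?_
    rw [← mul_assoc, hyx, mul_assoc, add_sub_cancel]
  have hym' : Measurable fun c => y c * (x τ * l) := by fun_prop
  have huncurry : Measurable (Function.uncurry fun c e => y c * (x e * g e)) := by
    simp only [Function.uncurry_def]; fun_prop
  have hgm : Measurable fun c => ENNReal.ofReal (Real.exp (-(M * c))) * g c := by fun_prop
  rw [setLIntegral_congr_fun measurableSet_Ico hA, lintegral_add_right _ hym',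
    lintegral_add_left hgm, lintegral_mul_const _ hym, setLIntegral_Ico_swap huncurry,
    ← lintegral_add_left hgm, max_eq_left hτ, hMx, add_assoc]
  -- In both terms the rejection clock of rate `k` has either rung by the given time or not, and
  -- these probabilities sum to one.
  congr 1
  · refine setLIntegral_congr_fun measurableSet_Ico fun e he => ?_
    rw [lintegral_mul_const _ hym, hMx]
    have := setLIntegral_exp_add hk0 he.1
    calc x e * ENNReal.ofReal (Real.exp (-(k * e))) * g e +
          (∫⁻ c in Set.Ico 0 e, y c) * (x e * g e)
        = ((∫⁻ c in Set.Ico 0 e, y c) + ENNReal.ofReal (Real.exp (-(k * e)))) * (x e * g e) := by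
          ring
      _ = x e * g e := by rw [this, one_mul]
  · have := setLIntegral_exp_add hk0 hτ
    calc (∫⁻ c in Set.Ico 0 τ, y c) * (x τ * l) + x τ * ENNReal.ofReal (Real.exp (-(k * τ))) * l
        = ((∫⁻ c in Set.Ico 0 τ, y c) + ENNReal.ofReal (Real.exp (-(k * τ)))) * (x τ * l) := by
          ring
      _ = x τ * l := by rw [this, one_mul]

/-! ### Suprema of increasing sequences of measures -/

/-- Setwise suprema of an increasing sequence form a measure, by monotone convergence for the
counting measure over the pieces; it is an upper bound of the sequence. -/
lemma iSup_measure_apply {Y : Type*} [MeasurableSpace Y] {μ : ℕ → Measure Y} (hμ : Monotone μ)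
    {B : Set Y} (hB : MeasurableSet B) : (⨆ n, μ n) B = ⨆ n, μ n B := by
  refine le_antisymm ?_ (iSup_le fun n => le_iSup μ n B)
  set ν : Measure Y := Measure.ofMeasurable (fun s _ => ⨆ n, μ n s) (by simp) (by
    intro f hf hd
    have hmono : Monotone fun n i => μ n (f i) := fun a b h i => hμ h (f i)
    have : ∀ n, μ n (⋃ i, f i) = ∫⁻ i, μ n (f i) ∂Measure.count := fun n => by
      rw [measure_iUnion hd hf, lintegral_count]
    simp_rw [this]
    rw [← lintegral_iSup (fun n => measurable_of_countable _) hmono, lintegral_count])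
  have hν : ∀ {s : Set Y}, MeasurableSet s → ν s = ⨆ n, μ n s := fun hs =>
    Measure.ofMeasurable_apply _ hs
  rw [← hν hB]
  refine (iSup_le fun n => ?_ : ⨆ n, μ n ≤ ν) B
  exact Measure.le_iff.2 fun s hs => by rw [hν hs]; exact le_iSup (fun n => μ n s) n

/-! ### One step of the recursion -/

/-- The law of a tree with a given first cut, if the laws of the subtrees are given by `F`. -/
noncomputable def nodeLaw (F : Set (Space d) → ℝ → Measure (CutTree d)) (D : Set (Space d))
    (c t : ℝ) (C : Cut d) : Measure (CutTree d) :=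
  ((F (leftPart D C) t).prod (F (rightPart D C) t)).map fun u => BinTree.node (c, C) u.1 u.2

open Classical in
/-- One step of the cutting procedure, if the laws of the subtrees are given by `F`. -/
noncomputable def step (F : Set (Space d) → ℝ → Measure (CutTree d)) (D : Set (Space d))
    (τ : ℝ) : Measure (CutTree d) :=
  if totalPerimeter (convexHull ℝ D) = 0 then Measure.dirac .leaf
  else (expMeasure (totalPerimeter (convexHull ℝ D)).toReal).bind fun c =>
    if c < τ then (cutLaw (convexHull ℝ D)).bind fun C => nodeLaw F D c (τ - c) C
    else Measure.dirac .leaf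

/-- The law of the recursive procedure that cuts convex hulls, up to `n` levels. -/
noncomputable abbrev hullLawUpTo (n : ℕ) (D : Set (Space d)) (τ : ℝ) : Measure (CutTree d) :=
  treeLawUpTo (fun A => convexHull ℝ A) n D τ

lemma hullLawUpTo_succ (n : ℕ) :
    (hullLawUpTo (n + 1) : Set (Space d) → ℝ → Measure (CutTree d)) = step (hullLawUpTo n) := rfl

/-- A measurable family of laws of trees of mass at most one, indexed by domain and budget. -/
structure IsRegular (F : Set (Space d) → ℝ → Measure (CutTree d)) : Prop where
  measurable : ∀ (X : Type) [TopologicalSpace X] [SecondCountableTopology X] [MeasurableSpace X]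
    [BorelSpace X] (D : X → Set (Space d)), IsClosedFamily D → (∀ x, Admissible (D x)) →
    Measurable fun z : X × ℝ => F (D z.1) z.2
  le_one : ∀ D, Admissible D → ∀ τ, F D τ Set.univ ≤ 1

section Step

variable {F F' : Set (Space d) → ℝ → Measure (CutTree d)}

lemma IsRegular.isFiniteMeasure (hF : IsRegular F) {D : Set (Space d)} (hD : Admissible D)
    (τ : ℝ) : IsFiniteMeasure (F D τ) :=
  ⟨(hF.le_one D hD τ).trans_lt ENNReal.one_lt_top⟩

lemma measurable_cutTree_node (c : ℝ) (C : Cut d) :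
    Measurable fun u : CutTree d × CutTree d => BinTree.node (c, C) u.1 u.2 :=
  BinTree.measurable_node.comp (f := fun u : CutTree d × CutTree d => ((c, C), u.1, u.2))
    (by fun_prop)

lemma nodeLaw_apply (F : Set (Space d) → ℝ → Measure (CutTree d)) (D : Set (Space d))
    (c t : ℝ) (C : Cut d) {B : Set (CutTree d)} (hB : MeasurableSet B) :
    nodeLaw F D c t C B = ((F (leftPart D C) t).prod (F (rightPart D C) t))
      ((fun u => BinTree.node (c, C) u.1 u.2) ⁻¹' B) :=
  Measure.map_apply (measurable_cutTree_node c C) hB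

lemma nodeLaw_univ (hF : IsRegular F) {D : Set (Space d)} (hD : Admissible D) (c t : ℝ)
    (C : Cut d) :
    nodeLaw F D c t C Set.univ = F (leftPart D C) t Set.univ * F (rightPart D C) t Set.univ := by
  have := hF.isFiniteMeasure (hD.rightPart C) t
  rw [nodeLaw_apply _ _ _ _ _ .univ, Set.preimage_univ, ← Set.univ_prod_univ,
    Measure.prod_prod]

lemma nodeLaw_univ_le_one (hF : IsRegular F) {D : Set (Space d)} (hD : Admissible D) (c t : ℝ)
    (C : Cut d) : nodeLaw F D c t C Set.univ ≤ 1 := by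
  rw [nodeLaw_univ hF hD]
  exact mul_le_one' (hF.le_one _ (hD.leftPart C) t) (hF.le_one _ (hD.rightPart C) t)

lemma IsRegular.measurable_nodeLaw (hF : IsRegular F) (X : Type) [TopologicalSpace X]
    [SecondCountableTopology X] [MeasurableSpace X] [BorelSpace X] {D : X → Set (Space d)}
    (hD : IsClosedFamily D) (hA : ∀ x, Admissible (D x)) :
    Measurable fun w : X × ℝ × ℝ × Cut d => nodeLaw F (D w.1) w.2.1 w.2.2.1 w.2.2.2 := by
  let κl : Kernel (X × ℝ × ℝ × Cut d) (CutTree d) :=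
    ⟨fun w => F (leftPart (D w.1) w.2.2.2) w.2.2.1,
      (hF.measurable (X × Cut d) _ ((hD.comp continuous_fst).leftPart continuous_snd)
        fun z => (hA z.1).leftPart z.2).comp
        (f := fun w : X × ℝ × ℝ × Cut d => ((w.1, w.2.2.2), w.2.2.1)) (by fun_prop)⟩
  let κr : Kernel (X × ℝ × ℝ × Cut d) (CutTree d) :=
    ⟨fun w => F (rightPart (D w.1) w.2.2.2) w.2.2.1,
      (hF.measurable (X × Cut d) _ ((hD.comp continuous_fst).rightPart continuous_snd)
        fun z => (hA z.1).rightPart z.2).comp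
        (f := fun w : X × ℝ × ℝ × Cut d => ((w.1, w.2.2.2), w.2.2.1)) (by fun_prop)⟩
  have : IsFiniteKernel κl :=
    ⟨1, ENNReal.one_lt_top, fun w => hF.le_one _ ((hA w.1).leftPart w.2.2.2) w.2.2.1⟩
  have : IsFiniteKernel κr :=
    ⟨1, ENNReal.one_lt_top, fun w => hF.le_one _ ((hA w.1).rightPart w.2.2.2) w.2.2.1⟩
  refine Measure.measurable_of_measurable_coe _ fun B hB => ?_
  have hS : MeasurableSet {z : (X × ℝ × ℝ × Cut d) × CutTree d × CutTree d |
      BinTree.node (z.1.2.1, z.1.2.2.2) z.2.1 z.2.2 ∈ B} :=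
    BinTree.measurable_node.comp (f := fun z : (X × ℝ × ℝ × Cut d) × CutTree d × CutTree d =>
      ((z.1.2.1, z.1.2.2.2), z.2.1, z.2.2)) (by fun_prop) hB
  convert Kernel.measurable_kernel_prodMk_left (κ := κl ×ₖ κr) hS using 2 with w
  rw [nodeLaw_apply _ _ _ _ _ hB, Kernel.prod_apply]
  rfl

/-- The probability of a set of trees after one step of the recursion. -/
lemma step_apply (hF : IsRegular F) {D : Set (Space d)} (hD : Admissible D) (τ : ℝ)
    {B : Set (CutTree d)} (hB : MeasurableSet B) :
    step F D τ B =
      (∫⁻ c in Set.Ico 0 τ, ENNReal.ofReal (Real.exp (-(rate D * c))) *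
        ∫⁻ C in cutsMeeting D, nodeLaw F D c (τ - c) C B ∂cutMeasure d) +
      ENNReal.ofReal (Real.exp (-(rate D * max τ 0))) * B.indicator 1 BinTree.leaf := by
  rw [step, totalPerimeter_eq hD]
  split_ifs with h0
  -- At rate zero the integral over cuts vanishes and the exponential is `1`, so the formula also
  -- gives a single leaf.
  · have hr : rate D = 0 := by rw [rate, h0, ENNReal.toReal_zero]
    rw [Measure.restrict_eq_zero.2 h0, hr]
    simp [Measure.dirac_apply' _ hB]
  · have hm := hF.measurable_nodeLaw Unit (isClosedFamily_const hD.isCompact) fun _ => hD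
    have hr : 0 < rate D := ENNReal.toReal_pos h0 (cutMeasure_cutsMeeting_ne_top hD)
    have hmC : ∀ c, Measurable fun C => nodeLaw F D c (τ - c) C := fun c =>
      hm.comp (f := fun C : Cut d => ((), c, τ - c, C)) (by fun_prop)
    have happ : ∀ c {B : Set (CutTree d)}, MeasurableSet B →
        ((cutLaw (convexHull ℝ D)).bind fun C => nodeLaw F D c (τ - c) C) B =
        (cutMeasure d (cutsMeeting D))⁻¹ *
          ∫⁻ C in cutsMeeting D, nodeLaw F D c (τ - c) C B ∂cutMeasure d := by
      intro c B hB
      rw [Measure.bind_apply hB (hmC c).aemeasurable, cutLaw_eq_cond hD, ProbabilityTheory.cond,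
        lintegral_smul_measure, smul_eq_mul]
    have hmcC : ∀ {B : Set (CutTree d)}, MeasurableSet B → Measurable fun c =>
        ∫⁻ C in cutsMeeting D, nodeLaw F D c (τ - c) C B ∂cutMeasure d := by
      intro B hB
      refine Measurable.lintegral_prod_right' (f := fun z : ℝ × Cut d =>
        nodeLaw F D z.1 (τ - z.1) z.2 B) ?_
      exact (Measure.measurable_coe hB).comp
        (hm.comp (f := fun z : ℝ × Cut d => ((), z.1, τ - z.1, z.2)) (by fun_prop))
    have hmc : Measurable fun c =>
        (cutLaw (convexHull ℝ D)).bind fun C => nodeLaw F D c (τ - c) C := by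
      refine Measure.measurable_of_measurable_coe _ fun B hB => ?_
      simp_rw [happ _ hB]
      exact (hmcC hB).const_mul _
    rw [Measure.bind_apply hB
      (Measurable.ite measurableSet_Iio hmc measurable_const).aemeasurable]
    have hmcB : Measurable fun c =>
        ((cutLaw (convexHull ℝ D)).bind fun C => nodeLaw F D c (τ - c) C) B :=
      (Measure.measurable_coe hB).comp hmc
    have hite : ∀ c, (if c < τ then
          (cutLaw (convexHull ℝ D)).bind fun C => nodeLaw F D c (τ - c) C
          else Measure.dirac .leaf : Measure (CutTree d)) B =
        if c < τ then ((cutLaw (convexHull ℝ D)).bind fun C => nodeLaw F D c (τ - c) C) B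
          else B.indicator 1 BinTree.leaf := fun c => by
      split_ifs
      · rfl
      · exact Measure.dirac_apply' _ hB
    simp_rw [hite]
    rw [show (cutMeasure d (cutsMeeting D)).toReal = rate D from rfl,
      lintegral_expMeasure_ite hr hmcB]
    congr 1
    refine setLIntegral_congr_fun measurableSet_Ico fun c _ => ?_
    -- The rate in the exponential density cancels the normalisation of the cut law.
    rw [happ c hB, ENNReal.ofReal_mul hr.le, ofReal_rate hD, mul_comm (cutMeasure d _), mul_assoc,
      ← mul_assoc (cutMeasure d _), ENNReal.mul_inv_cancel h0 (cutMeasure_cutsMeeting_ne_top hD),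
      one_mul]

/-- The mass of the first term in `step_apply` if all subtrees have mass one. -/
lemma setLIntegral_step_one {D : Set (Space d)} (hD : Admissible D) (τ : ℝ) :
    (∫⁻ c in Set.Ico 0 τ, ENNReal.ofReal (Real.exp (-(rate D * c))) *
        ∫⁻ _ in cutsMeeting D, 1 ∂cutMeasure d) +
      ENNReal.ofReal (Real.exp (-(rate D * max τ 0))) = 1 := by
  have h : ∀ c, ENNReal.ofReal (Real.exp (-(rate D * c))) *
      ∫⁻ _ in cutsMeeting D, 1 ∂cutMeasure d =
      ENNReal.ofReal (rate D * Real.exp (-(rate D * c))) := fun c => by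
    rw [setLIntegral_one, ← ofReal_rate hD, mul_comm, ← ENNReal.ofReal_mul (rate_nonneg D)]
  simp_rw [h]
  rcases le_total τ 0 with hτ | hτ
  · rw [Set.Ico_eq_empty (by linarith), max_eq_right hτ]
    simp
  · rw [max_eq_left hτ, setLIntegral_exp_add (rate_nonneg D) hτ]

lemma step_univ_le_one (hF : IsRegular F) {D : Set (Space d)} (hD : Admissible D) (τ : ℝ) :
    step F D τ Set.univ ≤ 1 := by
  rw [step_apply hF hD τ .univ, ← setLIntegral_step_one hD τ]
  simp only [Set.indicator_univ, Pi.one_apply, mul_one]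
  gcongr
  exact nodeLaw_univ_le_one hF hD _ _ _

lemma IsRegular.step (hF : IsRegular F) : IsRegular (step F) where
  le_one D hD τ := step_univ_le_one hF hD τ
  measurable X _ _ _ _ D hD hA := by
    refine Measure.measurable_of_measurable_coe _ fun B hB => ?_
    have hcm : MeasurableSet {z : X × Cut d | z.2 ∈ cutsMeeting (D z.1)} :=
      hD.isClosed_cutsMeeting.measurableSet
    have hrate : Measurable fun x => rate (D x) :=
      (measurable_measure_prodMk_left hcm).ennreal_toReal
    have hm := hF.measurable_nodeLaw X hD hA
    -- Indicators move the parameter-dependent domains of integration into the integrands.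
    have h1 : ∀ z : X × ℝ, BSP.step F (D z.1) z.2 B =
        (∫⁻ c, (Set.Ico 0 z.2).indicator (fun c => ENNReal.ofReal (Real.exp (-(rate (D z.1) * c))) *
          ∫⁻ C, (cutsMeeting (D z.1)).indicator
            (fun C => nodeLaw F (D z.1) c (z.2 - c) C B) C ∂cutMeasure d) c) +
        ENNReal.ofReal (Real.exp (-(rate (D z.1) * max z.2 0))) * B.indicator 1 BinTree.leaf := by
      intro z
      rw [step_apply hF (hA z.1) z.2 hB, lintegral_indicator measurableSet_Ico]
      simp_rw [lintegral_indicator (hA z.1).measurableSet_cutsMeeting]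
    simp_rw [h1]
    refine Measurable.add ?_ (((hrate.comp measurable_fst).mul
      (by fun_prop : Measurable fun z : X × ℝ => max z.2 0)).neg.exp.ennreal_ofReal.mul_const _)
    refine Measurable.lintegral_prod_right' (f := fun w : (X × ℝ) × ℝ =>
      (Set.Ico 0 w.1.2).indicator (fun c => ENNReal.ofReal (Real.exp (-(rate (D w.1.1) * c))) *
          ∫⁻ C, (cutsMeeting (D w.1.1)).indicator
            (fun C => nodeLaw F (D w.1.1) c (w.1.2 - c) C B) C ∂cutMeasure d) w.2) ?_
    have hS : MeasurableSet {w : (X × ℝ) × ℝ | w.2 ∈ Set.Ico 0 w.1.2} :=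
      (measurableSet_le measurable_const measurable_snd).inter
        (measurableSet_lt measurable_snd (by fun_prop))
    refine Measurable.indicator (f := fun w : (X × ℝ) × ℝ =>
      ENNReal.ofReal (Real.exp (-(rate (D w.1.1) * w.2))) *
          ∫⁻ C, (cutsMeeting (D w.1.1)).indicator
            (fun C => nodeLaw F (D w.1.1) w.2 (w.1.2 - w.2) C B) C ∂cutMeasure d) ?_ hS
    refine Measurable.mul ((hrate.comp (f := fun w : (X × ℝ) × ℝ => w.1.1) (by fun_prop)).mul
      measurable_snd).neg.exp.ennreal_ofReal ?_
    refine Measurable.lintegral_prod_right' (f := fun v : ((X × ℝ) × ℝ) × Cut d =>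
      (cutsMeeting (D v.1.1.1)).indicator
            (fun C => nodeLaw F (D v.1.1.1) v.1.2 (v.1.1.2 - v.1.2) C B) v.2) ?_
    refine Measurable.indicator (f := fun v : ((X × ℝ) × ℝ) × Cut d =>
      nodeLaw F (D v.1.1.1) v.1.2 (v.1.1.2 - v.1.2) v.2 B)
      ((Measure.measurable_coe hB).comp (hm.comp (f := fun v : ((X × ℝ) × ℝ) × Cut d =>
        (v.1.1.1, v.1.2, v.1.1.2 - v.1.2, v.2)) (by fun_prop)))
      ((by fun_prop : Measurable fun v : ((X × ℝ) × ℝ) × Cut d => (v.1.1.1, v.2)) hcm)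

lemma nodeLaw_mono (hF' : IsRegular F') (h : ∀ D, Admissible D → ∀ τ, F D τ ≤ F' D τ)
    {D : Set (Space d)} (hD : Admissible D) (c t : ℝ) (C : Cut d) :
    nodeLaw F D c t C ≤ nodeLaw F' D c t C := by
  have := hF'.isFiniteMeasure (hD.rightPart C) t
  exact Measure.map_mono (Measure.prod_mono (h _ (hD.leftPart C) t) (h _ (hD.rightPart C) t))
    (measurable_cutTree_node c C)

lemma step_mono (hF : IsRegular F) (hF' : IsRegular F')
    (h : ∀ D, Admissible D → ∀ τ, F D τ ≤ F' D τ) {D : Set (Space d)} (hD : Admissible D) (τ : ℝ) :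
    step F D τ ≤ step F' D τ := by
  refine Measure.le_iff.2 fun B hB => ?_
  rw [step_apply hF hD τ hB, step_apply hF' hD τ hB]
  gcongr
  exact nodeLaw_mono hF' h hD _ _ _

end Step

/-! ### The recursion stops -/

lemma isRegular_zero : IsRegular (fun (_ : Set (Space d)) (_ : ℝ) => (0 : Measure (CutTree d))) where
  measurable _ _ _ _ _ _ _ _ := measurable_const
  le_one _ _ _ := by simp

lemma isRegular_hullLawUpTo (n : ℕ) : IsRegular (hullLawUpTo (d := d) n) := by
  induction n with
  | zero => exact isRegular_zero
  | succ n ih => rw [hullLawUpTo_succ]; exact ih.step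

lemma hullLawUpTo_le_succ (n : ℕ) {D : Set (Space d)} (hD : Admissible D) (τ : ℝ) :
    hullLawUpTo n D τ ≤ hullLawUpTo (n + 1) D τ := by
  induction n generalizing D τ with
  | zero => exact Measure.zero_le _
  | succ n ih =>
    rw [hullLawUpTo_succ (n + 1), hullLawUpTo_succ n]
    exact step_mono (isRegular_hullLawUpTo n) (isRegular_hullLawUpTo (n + 1))
      (fun D hD τ => ih hD τ) hD τ

lemma monotone_hullLawUpTo {D : Set (Space d)} (hD : Admissible D) (τ : ℝ) :
    Monotone fun n => hullLawUpTo n D τ :=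
  monotone_nat_of_le_succ fun n => hullLawUpTo_le_succ n hD τ

/-- The probability that the recursion has at least `n` levels decays geometrically. -/
lemma one_le_hullLawUpTo_add {L : ℝ} (hL : 0 < L) (n : ℕ) {D : Set (Space d)}
    (hD : Admissible D) (hDL : rate D ≤ L) {τ : ℝ} (hτ : 0 ≤ τ) :
    1 ≤ hullLawUpTo n D τ Set.univ + ENNReal.ofReal ((1 / 2) ^ n * Real.exp (4 * L * τ)) := by
  induction n generalizing D τ with
  | zero =>
    refine le_add_left ?_
    rw [pow_zero, one_mul, ENNReal.one_le_ofReal]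
    exact Real.one_le_exp (by positivity)
  | succ n ih =>
    set ε : ℝ → ENNReal := fun t => ENNReal.ofReal ((1 / 2) ^ n * Real.exp (4 * L * t))
    have hF := isRegular_hullLawUpTo (d := d) n
    -- A union bound over the two subtrees, in additive form to avoid truncated subtraction.
    have hnode : ∀ c ∈ Set.Ico 0 τ, ∀ C,
        1 ≤ nodeLaw (hullLawUpTo n) D c (τ - c) C Set.univ + 2 * ε (τ - c) := by
      intro c hc C
      rw [nodeLaw_univ hF hD]
      have hsub : ∀ {E : Set (Space d)}, E ⊆ D → rate E ≤ L := fun h =>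
        (rate_mono hD (h.trans (subset_convexHull ℝ D))).trans hDL
      have hl := ih (hD.leftPart C) (hsub (Set.sep_subset _ _)) (sub_nonneg.2 hc.2.le)
      have hr := ih (hD.rightPart C) (hsub (Set.sep_subset _ _)) (sub_nonneg.2 hc.2.le)
      have hr1 := hF.le_one _ (hD.rightPart C) (τ - c)
      set a := hullLawUpTo n (leftPart D C) (τ - c) Set.univ
      set b := hullLawUpTo n (rightPart D C) (τ - c) Set.univ
      calc 1 ≤ b + ε (τ - c) := hr
        _ = 1 * b + ε (τ - c) := by rw [one_mul]
        _ ≤ (a + ε (τ - c)) * b + ε (τ - c) := by gcongr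
        _ = a * b + ε (τ - c) * b + ε (τ - c) := by ring
        _ ≤ a * b + ε (τ - c) * 1 + ε (τ - c) := by gcongr
        _ = a * b + 2 * ε (τ - c) := by ring
    -- The constant `4` is two subtrees times two for the halving: `L * 2 * exp (4 * L * (τ - c))`
    -- is half of `exp (4 * L * τ)` times an exponential density of rate `4 * L`.
    have herr : ∫⁻ c in Set.Ico 0 τ, ENNReal.ofReal (Real.exp (-(rate D * c))) *
        ∫⁻ _ in cutsMeeting D, 2 * ε (τ - c) ∂cutMeasure d ≤
        ENNReal.ofReal ((1 / 2) ^ (n + 1) * Real.exp (4 * L * τ)) := by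
      calc _ ≤ ∫⁻ c in Set.Ico 0 τ, ENNReal.ofReal ((1 / 2) ^ (n + 1) * Real.exp (4 * L * τ)) *
            ENNReal.ofReal (4 * L * Real.exp (-(4 * L * c))) := by
            refine setLIntegral_mono (by fun_prop) fun c hc => ?_
            rw [setLIntegral_const, ← ofReal_rate hD, show (2 : ENNReal) = ENNReal.ofReal 2 by simp,
              ← ENNReal.ofReal_mul (by norm_num), ← ENNReal.ofReal_mul (by positivity),
              ← ENNReal.ofReal_mul (Real.exp_pos _).le, ← ENNReal.ofReal_mul (by positivity)]
            refine ENNReal.ofReal_le_ofReal ?_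
            have h1 : Real.exp (-(rate D * c)) ≤ 1 :=
              Real.exp_le_one_iff.2 (by have := mul_nonneg (rate_nonneg D) hc.1; linarith)
            have h2 : Real.exp (4 * L * (τ - c)) =
                Real.exp (4 * L * τ) * Real.exp (-(4 * L * c)) := by
              rw [← Real.exp_add]; congr 1; ring
            calc _ ≤ 1 * (2 * ((1 / 2) ^ n * Real.exp (4 * L * (τ - c))) * L) := by
                  have := rate_nonneg D
                  gcongr
              _ = _ := by rw [h2, pow_succ]; ring
        _ ≤ ENNReal.ofReal ((1 / 2) ^ (n + 1) * Real.exp (4 * L * τ)) * 1 := by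
            rw [lintegral_const_mul _ (by fun_prop)]
            gcongr
            rw [← setLIntegral_exp_add (by positivity : 0 ≤ 4 * L) hτ]
            exact le_self_add
        _ = _ := mul_one _
    have hεm : Measurable ε := by fun_prop
    rw [hullLawUpTo_succ, step_apply hF hD τ .univ, Set.indicator_univ, Pi.one_apply, mul_one]
    calc (1 : ENNReal) = _ := (setLIntegral_step_one hD τ).symm
      _ ≤ (∫⁻ c in Set.Ico 0 τ, (ENNReal.ofReal (Real.exp (-(rate D * c))) *
            ∫⁻ C in cutsMeeting D, nodeLaw (hullLawUpTo n) D c (τ - c) C Set.univ ∂cutMeasure d) +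
            ENNReal.ofReal (Real.exp (-(rate D * c))) *
              ∫⁻ _ in cutsMeeting D, 2 * ε (τ - c) ∂cutMeasure d) +
          ENNReal.ofReal (Real.exp (-(rate D * max τ 0))) := by
          refine add_le_add_left (lintegral_mono_ae ?_) _
          filter_upwards [ae_restrict_mem measurableSet_Ico] with c hc
          rw [← mul_add, ← lintegral_add_right _ measurable_const]
          gcongr with C
          exact hnode c hc C
      _ ≤ _ := by
          rw [lintegral_add_right _ (by simp_rw [setLIntegral_const]; fun_prop), add_right_comm]
          exact add_le_add le_rfl herr

/-- The law of the output of the recursive procedure that cuts convex hulls. -/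
noncomputable abbrev hullLaw (D : Set (Space d)) (τ : ℝ) : Measure (CutTree d) :=
  treeLaw (fun A => convexHull ℝ A) D τ

lemma hullLaw_apply {D : Set (Space d)} (hD : Admissible D) (τ : ℝ) {B : Set (CutTree d)}
    (hB : MeasurableSet B) : hullLaw D τ B = ⨆ n, hullLawUpTo n D τ B :=
  iSup_measure_apply (monotone_hullLawUpTo hD τ) hB

lemma isRegular_hullLaw : IsRegular (hullLaw (d := d)) where
  le_one D hD τ := by
    rw [hullLaw_apply hD τ .univ]
    exact iSup_le fun n => (isRegular_hullLawUpTo n).le_one D hD τ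
  measurable X _ _ _ _ D hD hA := by
    refine Measure.measurable_of_measurable_coe _ fun B hB => ?_
    simp_rw [fun z : X × ℝ => hullLaw_apply (hA z.1) z.2 hB]
    exact .iSup fun n => (Measure.measurable_coe hB).comp
      ((isRegular_hullLawUpTo n).measurable X D hD hA)

/-- The recursion stops almost surely. -/
theorem isProbabilityMeasure_hullLaw {D : Set (Space d)} (hD : Admissible D) (τ : ℝ) :
    IsProbabilityMeasure (hullLaw D τ) := by
  refine ⟨le_antisymm (isRegular_hullLaw.le_one D hD τ) ?_⟩
  have hle : ∀ n, hullLawUpTo n D τ Set.univ ≤ hullLaw D τ Set.univ := fun n => by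
    rw [hullLaw_apply hD τ .univ]
    exact le_iSup (fun n => hullLawUpTo n D τ Set.univ) n
  rcases lt_or_ge τ 0 with hτ | hτ
  · refine le_trans ?_ (hle 1)
    rw [hullLawUpTo_succ, step_apply (isRegular_hullLawUpTo 0) hD τ .univ,
      Set.Ico_eq_empty (by linarith), max_eq_right hτ.le]
    simp
  -- The bound needs a positive rate, while `rate D` may be zero.
  · have hL : 0 < rate D + 1 := by linarith [rate_nonneg D]
    have hlim : Filter.Tendsto (fun n : ℕ => hullLaw D τ Set.univ +
        ENNReal.ofReal ((1 / 2) ^ n * Real.exp (4 * (rate D + 1) * τ))) Filter.atTop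
        (nhds (hullLaw D τ Set.univ + ENNReal.ofReal (0 * Real.exp (4 * (rate D + 1) * τ)))) :=
      tendsto_const_nhds.add (ENNReal.tendsto_ofReal
        ((tendsto_pow_atTop_nhds_zero_of_lt_one (by norm_num) (by norm_num)).mul_const _))
    rw [zero_mul, ENNReal.ofReal_zero, add_zero] at hlim
    exact ge_of_tendsto' hlim fun n =>
      (one_le_hullLawUpTo_add hL n hD (by linarith) hτ).trans (add_le_add_left (hle n) _)

/-- The law of the output is a fixed point of the recursion. -/
lemma step_hullLaw {D : Set (Space d)} (hD : Admissible D) (τ : ℝ) :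
    step hullLaw D τ = hullLaw D τ := by
  have := isProbabilityMeasure_hullLaw hD τ
  have : IsFiniteMeasure (hullLaw D τ) := inferInstance
  -- One inequality is enough: the left side has mass one and a step has mass at most one.
  -- Continuity of `step` along suprema is not needed.
  have hle : hullLaw D τ ≤ step hullLaw D τ := by
    refine iSup_le fun n => (hullLawUpTo_le_succ n hD τ).trans ?_
    rw [hullLawUpTo_succ]
    exact step_mono (isRegular_hullLawUpTo n) isRegular_hullLaw
      (fun D _ τ => le_iSup (fun n => hullLawUpTo n D τ) n) hD τ
  have hfin : IsFiniteMeasure (step hullLaw D τ) :=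
    ⟨(step_univ_le_one isRegular_hullLaw hD τ).trans_lt ENNReal.one_lt_top⟩
  refine (Measure.eq_of_le_of_measure_univ_eq hle (le_antisymm (hle _) ?_)).symm
  rw [measure_univ (μ := hullLaw D τ)]
  exact step_univ_le_one isRegular_hullLaw hD τ

/-! ### The law of the restriction -/

lemma nodeLaw_preimage_shift (F : Set (Space d) → ℝ → Measure (CutTree d)) (D : Set (Space d))
    (a c t : ℝ) (C : Cut d) {B : Set (CutTree d)} (hB : MeasurableSet B) :
    nodeLaw F D c t C (shift a ⁻¹' B) = nodeLaw F D (a + c) t C B := by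
  rw [nodeLaw_apply _ _ _ _ _ (measurable_shift a hB), nodeLaw_apply _ _ _ _ _ hB]
  rfl

lemma leftPart_mono {D K : Set (Space d)} (h : D ⊆ K) (C : Cut d) :
    leftPart D C ⊆ leftPart K C := fun _ hx => ⟨h hx.1, hx.2⟩

lemma rightPart_mono {D K : Set (Space d)} (h : D ⊆ K) (C : Cut d) :
    rightPart D C ⊆ rightPart K C := fun _ hx => ⟨h hx.1, hx.2⟩

lemma Convex.leftPart {K : Set (Space d)} (hK : Convex ℝ K) (C : Cut d) :
    Convex ℝ (leftPart K C) := hK.inter (convex_offset_le C)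

lemma Convex.rightPart {K : Set (Space d)} (hK : Convex ℝ K) (C : Cut d) :
    Convex ℝ (rightPart K C) := by
  rw [rightPart_eq_leftPart_flip]; exact Convex.leftPart hK _

/-- The inductive form of thinning. Truncation at `n` levels of cuts of `K` loses mass, and skipped
cuts use up levels, so only an inequality with the full law in `D` can be carried along. -/
lemma hullLawUpTo_map_restrict_le (n : ℕ) {K D : Set (Space d)} (hK : Admissible K)
    (hKc : Convex ℝ K) (hD : Admissible D) (hDK : D ⊆ K) (τ : ℝ) :
    (hullLawUpTo n K τ).map (fun t => restrictHull t D 0) ≤ hullLaw D τ := by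
  induction n generalizing K D τ with
  | zero =>
    show Measure.map _ (0 : Measure (CutTree d)) ≤ _
    rw [Measure.map_zero]
    exact Measure.zero_le _
  | succ n ih =>
    have hF := isRegular_hullLawUpTo (d := d) n
    have hT := isRegular_hullLaw (d := d)
    have hres : ∀ {E : Set (Space d)}, Admissible E →
        Measurable fun t : CutTree d => restrictHull t E 0 := fun hE =>
      measurable_restrictHull hE.isCompact 0
    have hDK' : D ⊆ convexHull ℝ K := hDK.trans (subset_convexHull ℝ K)
    refine Measure.le_iff.2 fun B hB => ?_
    have hshift : ∀ c, MeasurableSet (shift c ⁻¹' B : Set (CutTree d)) := fun c =>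
      measurable_shift c hB
    rw [Measure.map_apply (hres hD) hB, hullLawUpTo_succ, step_apply hF hK τ (hres hD hB)]
    -- A kept cut restricts the two independent subtrees separately, so the induction hypothesis
    -- passes to the product.
    have hmeet : ∀ c t, ∀ C ∈ cutsMeeting D,
        nodeLaw (hullLawUpTo n) K c t C ((fun t => restrictHull t D 0) ⁻¹' B) ≤
          nodeLaw hullLaw D c t C B := by
      intro c t C hC
      have := hF.isFiniteMeasure (hK.rightPart C) t
      have := hF.isFiniteMeasure (hK.leftPart C) t
      have := hT.isFiniteMeasure (hD.rightPart C) t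
      rw [nodeLaw_apply _ _ _ _ _ (hres hD hB), nodeLaw_apply _ _ _ _ _ hB]
      have hset : (fun u : CutTree d × CutTree d => BinTree.node (c, C) u.1 u.2) ⁻¹'
          ((fun t => restrictHull t D 0) ⁻¹' B) =
          Prod.map (fun t => restrictHull t (leftPart D C) 0)
            (fun t => restrictHull t (rightPart D C) 0) ⁻¹'
          ((fun u : CutTree d × CutTree d => BinTree.node (c, C) u.1 u.2) ⁻¹' B) := by
        ext u
        simp only [Set.mem_preimage, Prod.map]
        rw [restrictHull_node, if_pos hC, zero_add]
      rw [hset, ← Measure.map_apply ((hres (hD.leftPart C)).prodMap (hres (hD.rightPart C)))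
        (measurable_cutTree_node c C hB),
        ← Measure.map_prod_map _ _ (hres (hD.leftPart C)) (hres (hD.rightPart C))]
      exact Measure.prod_mono
        (ih (hK.leftPart C) (Convex.leftPart hKc C) (hD.leftPart C) (leftPart_mono hDK C) t)
        (ih (hK.rightPart C) (Convex.rightPart hKc C) (hD.rightPart C) (rightPart_mono hDK C) t) _
    -- Only the subtree on the side of `D` matters; the other integrates out with mass at most one,
    -- and the cost `c` remains as a shift.
    have hmiss : ∀ c t, ∀ C ∉ cutsMeeting D,
        nodeLaw (hullLawUpTo n) K c t C ((fun t => restrictHull t D 0) ⁻¹' B) ≤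
          hullLaw D t (shift c ⁻¹' B) := by
      intro c t C hC
      have := hF.isFiniteMeasure (hK.rightPart C) t
      have := hF.isFiniteMeasure (hK.leftPart C) t
      rw [nodeLaw_apply _ _ _ _ _ (hres hD hB)]
      by_cases hr : (rightPart D C).Nonempty
      · have hset : (fun u : CutTree d × CutTree d => BinTree.node (c, C) u.1 u.2) ⁻¹'
            ((fun t => restrictHull t D 0) ⁻¹' B) =
            Set.univ ×ˢ ((fun t => restrictHull t D 0) ⁻¹' (shift c ⁻¹' B)) := by
          ext u
          simp only [Set.mem_preimage, Set.mem_prod, Set.mem_univ, true_and]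
          rw [restrictHull_node, if_neg hC, if_pos hr, zero_add, restrictHull_eq_shift]
        have hsub : D ⊆ rightPart K C := fun x hx => ⟨hDK hx, by
          by_contra h
          exact hC ⟨⟨x, hx, (not_le.1 h).le⟩, hr⟩⟩
        rw [hset, Measure.prod_prod, ← Measure.map_apply (hres hD) (hshift c)]
        calc _ ≤ 1 * hullLaw D t (shift c ⁻¹' B) := by
              gcongr
              · exact hF.le_one _ (hK.leftPart C) t
              · exact ih (hK.rightPart C) (Convex.rightPart hKc C) hD hsub t
          _ = _ := one_mul _
      · have hset : (fun u : CutTree d × CutTree d => BinTree.node (c, C) u.1 u.2) ⁻¹'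
            ((fun t => restrictHull t D 0) ⁻¹' B) =
            ((fun t => restrictHull t D 0) ⁻¹' (shift c ⁻¹' B)) ×ˢ Set.univ := by
          ext u
          simp only [Set.mem_preimage, Set.mem_prod, Set.mem_univ, and_true]
          rw [restrictHull_node, if_neg hC, if_neg hr, zero_add, restrictHull_eq_shift]
        have hsub : D ⊆ leftPart K C := fun x hx => ⟨hDK hx, by
          by_contra h
          exact hr ⟨x, hx, (not_le.1 h).le⟩⟩
        rw [hset, Measure.prod_prod, ← Measure.map_apply (hres hD) (hshift c)]
        calc _ ≤ hullLaw D t (shift c ⁻¹' B) * 1 := by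
              gcongr
              · exact ih (hK.leftPart C) (Convex.leftPart hKc C) hD hsub t
              · exact hF.le_one _ (hK.rightPart C) t
          _ = _ := mul_one _
    set g : ℝ → ENNReal := fun e =>
      ∫⁻ C in cutsMeeting D, nodeLaw hullLaw D e (τ - e) C B ∂cutMeasure d with hg
    have hgm : Measurable g := by
      refine Measurable.lintegral_prod_right' (f := fun z : ℝ × Cut d =>
        nodeLaw hullLaw D z.1 (τ - z.1) z.2 B) ?_
      exact (Measure.measurable_coe hB).comp
        ((hT.measurable_nodeLaw Unit (isClosedFamily_const hD.isCompact) fun _ => hD).comp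
          (f := fun z : ℝ × Cut d => ((), z.1, τ - z.1, z.2)) (by fun_prop))
    have hdiff : cutMeasure d (cutsMeeting K \ cutsMeeting D) =
        ENNReal.ofReal (rate K - rate D) := by
      rw [measure_sdiff (cutsMeeting_mono hDK') hD.measurableSet_cutsMeeting.nullMeasurableSet
        (cutMeasure_cutsMeeting_ne_top hD), ENNReal.ofReal_sub _ (rate_nonneg D), ofReal_rate hD,
        ofReal_rate hK]
    have hinner : ∀ c, ∫⁻ C in cutsMeeting K, nodeLaw (hullLawUpTo n) K c (τ - c) C
          ((fun t => restrictHull t D 0) ⁻¹' B) ∂cutMeasure d ≤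
        g c + ENNReal.ofReal (rate K - rate D) *
          ((∫⁻ b in Set.Ico 0 (τ - c), ENNReal.ofReal (Real.exp (-(rate D * b))) * g (c + b)) +
            ENNReal.ofReal (Real.exp (-(rate D * max (τ - c) 0))) *
              B.indicator 1 BinTree.leaf) := by
      intro c
      -- Unfold one step in `D` after the wasted time `c`: a cut at further time `b` carries cost `c
      -- + b` and leaves the budget `τ - (c + b)`, hence `g (c + b)`.
      have hshiftlaw : hullLaw D (τ - c) (shift c ⁻¹' B) =
          (∫⁻ b in Set.Ico 0 (τ - c), ENNReal.ofReal (Real.exp (-(rate D * b))) * g (c + b)) +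
            ENNReal.ofReal (Real.exp (-(rate D * max (τ - c) 0))) *
              B.indicator 1 BinTree.leaf := by
        rw [← step_hullLaw hD, step_apply hT hD _ (hshift c)]
        congr 1
        refine lintegral_congr fun b => ?_
        simp only [hg, nodeLaw_preimage_shift _ _ _ _ _ _ hB, sub_sub]
      rw [← hshiftlaw, ← lintegral_inter_add_sdiff _ _ hD.measurableSet_cutsMeeting,
        Set.inter_eq_right.2 (cutsMeeting_mono hDK')]
      refine add_le_add ?_ ?_
      · exact setLIntegral_mono' hD.measurableSet_cutsMeeting fun C hC => hmeet c (τ - c) C hC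
      · rw [mul_comm, ← hdiff, ← setLIntegral_const]
        exact setLIntegral_mono'
          (hK.measurableSet_cutsMeeting.diff hD.measurableSet_cutsMeeting)
          fun C hC => hmiss c (τ - c) C hC.2
    -- Thinning with `M = rate K` and `m = rate D`; the rejected cuts have measure `rate K - rate D`
    -- by `hdiff`.
    rw [← step_hullLaw hD, step_apply hT hD τ hB,
      ← exponential_thinning (rate_mono hK hDK') hgm (B.indicator 1 BinTree.leaf)]
    refine add_le_add (lintegral_mono fun c => ?_) le_rfl
    gcongr
    exact hinner c

/-- The restriction of the tree on a polytope to a domain inside has the law of the tree that is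
generated in the domain. -/
theorem hullLaw_map_restrict {K D : Set (Space d)} (hK : Admissible K) (hKc : Convex ℝ K)
    (hD : Admissible D) (hDK : D ⊆ K) (τ : ℝ) :
    (hullLaw K τ).map (fun t => restrictHull t D 0) = hullLaw D τ := by
  have hres := measurable_restrictHull hD.isCompact 0
  have := isProbabilityMeasure_hullLaw hK τ
  have := isProbabilityMeasure_hullLaw hD τ
  have := Measure.isProbabilityMeasure_map (μ := hullLaw K τ) hres.aemeasurable
  refine Measure.eq_of_le_of_isProbabilityMeasure (Measure.le_iff.2 fun B hB => ?_)
  rw [Measure.map_apply hres hB, hullLaw_apply hK τ (hres hB)]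
  refine iSup_le fun n => ?_
  rw [← Measure.map_apply hres hB]
  exact hullLawUpTo_map_restrict_le n hK hKc hD hDK τ B

/-! ### Blocks are their own convex hulls -/

/-- The parts of a convex block are convex, so taking hulls changes nothing at any level. -/
lemma treeLawUpTo_id (n : ℕ) {K : Set (Space d)} (hK : Convex ℝ K) (τ : ℝ) :
    treeLawUpTo id n K τ = hullLawUpTo n K τ := by
  induction n generalizing K τ with
  | zero => rfl
  | succ n ih =>
    simp only [hullLawUpTo, treeLawUpTo, id, hK.convexHull_eq]
    simp only [ih (Convex.leftPart hK _), ih (Convex.rightPart hK _)]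

lemma blockCutLaw_eq {K : Set (Space d)} (hK : Convex ℝ K) (τ : ℝ) :
    blockCutLaw K τ = hullLaw K τ := by
  simp only [blockCutLaw, hullLaw, treeLaw, treeLawUpTo_id _ hK]

lemma restrictFrom_id (t : CutTree d) {K : Set (Space d)} (hK : Convex ℝ K) (a : ℝ) :
    restrictFrom id t K a = restrictHull t K a := by
  induction t generalizing K a with
  | leaf => rfl
  | node cC l r ihl ihr =>
    obtain ⟨c, C⟩ := cC
    simp only [restrictHull, restrictFrom, id]
    simp only [ihl hK, ihr hK, ihl (Convex.leftPart hK C), ihr (Convex.rightPart hK C)]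
    have hiff : (hyperplane (convexHull ℝ K) C).Nonempty ↔ (hyperplane K C).Nonempty := by
      rw [hK.convexHull_eq]
    by_cases h : (hyperplane K C).Nonempty
    · rw [if_pos h, if_pos (hiff.2 h)]
    · rw [if_neg h, if_neg (mt hiff.1 h)]

/-! ### The main result -/

/-- A cut generated in a domain inside `K` is a cut generated in `K` conditioned on meeting the
domain. -/
theorem cutLaw_eq_cond_cutLaw {K D : Set (Space d)} (hK : Admissible K) (hKc : Convex ℝ K)
    (hD : Admissible D) (hDK : D ⊆ K) :
    cutLaw (convexHull ℝ D) =
      ProbabilityTheory.cond (cutLaw K) {C | (hyperplane (convexHull ℝ D) C).Nonempty} := by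
  have h := cutLaw_eq_cond hK
  rw [hKc.convexHull_eq] at h
  rw [h, ← cutsMeeting_eq, cutLaw_eq_cond hD,
    cond_cond_eq_cond_inter' hK.measurableSet_cutsMeeting hD.measurableSet_cutsMeeting
      (cutMeasure_cutsMeeting_ne_top hK),
    Set.inter_eq_right.2 (cutsMeeting_mono (hDK.trans (subset_convexHull ℝ K)))]

end BSP

theorem corollary1 (d : ℕ) (F S : Finset (BSP.Space d))
    (hS : (S : Set (BSP.Space d)) ⊆ convexHull ℝ (F : Set (BSP.Space d))) :
    (BSP.totalPerimeter (convexHull ℝ (S : Set (BSP.Space d))) ≠ 0 →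
      MeasureTheory.IsProbabilityMeasure
        (BSP.cutLaw (convexHull ℝ (S : Set (BSP.Space d)))) ∧
      BSP.cutLaw (convexHull ℝ (S : Set (BSP.Space d))) =
        ProbabilityTheory.cond (BSP.cutLaw (convexHull ℝ (F : Set (BSP.Space d))))
          {C | (BSP.hyperplane (convexHull ℝ (S : Set (BSP.Space d))) C).Nonempty}) ∧
    ∀ τ : ℝ,
      MeasureTheory.IsProbabilityMeasure
        (BSP.blockCutLaw (convexHull ℝ (F : Set (BSP.Space d))) τ) ∧
      MeasureTheory.IsProbabilityMeasure (BSP.hullCutLaw (S : Set (BSP.Space d)) τ) ∧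
      BSP.hullCutLaw (S : Set (BSP.Space d)) τ =
        (BSP.blockCutLaw (convexHull ℝ (F : Set (BSP.Space d))) τ).map
          (BSP.restrictToHulls (S : Set (BSP.Space d))) ∧
      BSP.blockCutLaw (convexHull ℝ (S : Set (BSP.Space d))) τ =
        (BSP.blockCutLaw (convexHull ℝ (F : Set (BSP.Space d))) τ).map
          (BSP.restrictToBlock (convexHull ℝ (S : Set (BSP.Space d)))) := by
  have hK : BSP.Admissible (convexHull ℝ (F : Set (BSP.Space d))) := Or.inr ⟨F, rfl⟩
  have hKc := convex_convexHull ℝ (F : Set (BSP.Space d))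
  have hD : BSP.Admissible (S : Set (BSP.Space d)) := Or.inl S.finite_toSet
  have hH : BSP.Admissible (convexHull ℝ (S : Set (BSP.Space d))) := Or.inr ⟨S, rfl⟩
  have hHc := convex_convexHull ℝ (S : Set (BSP.Space d))
  refine ⟨fun h0 => ⟨?_, BSP.cutLaw_eq_cond_cutLaw hK hKc hD hS⟩, fun τ => ⟨?_, ?_, ?_, ?_⟩⟩
  · rw [BSP.totalPerimeter_eq hD] at h0
    rw [BSP.cutLaw_eq_cond hD]
    exact cond_isProbabilityMeasure_of_finite h0 (BSP.cutMeasure_cutsMeeting_ne_top hD)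
  · rw [BSP.blockCutLaw_eq hKc]
    exact BSP.isProbabilityMeasure_hullLaw hK τ
  · exact BSP.isProbabilityMeasure_hullLaw hD τ
  -- The same restriction theorem serves twice: here with the finite domain `S`, below with the
  -- polytope `conv S`.
  · rw [BSP.blockCutLaw_eq hKc]
    exact (BSP.hullLaw_map_restrict hK hKc hD hS τ).symm
  · rw [BSP.blockCutLaw_eq hKc, BSP.blockCutLaw_eq hHc,
      ← BSP.hullLaw_map_restrict hK hKc hH (convexHull_min hS hKc) τ]
    congr 1
    funext t
    exact (BSP.restrictFrom_id t hHc 0).symm
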